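/- Let $p$ be a prime, $n\ge 1$, and equip $\mathbb{Q}_p^n$ with $|x|_p=\max_j|x_j|_p$ and with the Haar measure $|\cdot|_h$ normalized so that the closed unit ball has measure $1$. For $\gamma\in\mathbb{Z}$ let $B_\gamma(x)=\{y:|y-x|_p\le p^\gamma\}$. For measurable $f$ put $$\mathcal{M}^p(f)(x)=\sup_{\gamma\in\mathbb{Z}}\frac1{|B_\gamma(x)|_h}\int_{B_\gamma(x)}|f(y)|\,dy ,\qquad \mathcal{M}^p_{B}(f)(x)=\sup_{\gamma:\,B_\gamma(x)\subset B}\frac1{|B_\gamma(x)|_h}\int_{B_\gamma(x)}|f(y)|\,dy$$ for a ball $B$, and $[b,\mathcal{M}^p](f)=b\,\mathcal{M}^p(f)-\mathcal{M}^p(bf)$. Let $q_-(E)$ and $q_+(E)$ be the essential infimum and supremum of $q(\cdot)$ over $E$, and $q_\pm=q_\pm(\mathbb{Q}_p^n)$. Let $\mathscr{P}$ be the set of measurable $q(\cdot):\mathbb{Q}_p^n\to(1,\infty)$ with $1<q_-\le q(x)\le q_+<\infty$ for all $x$, and $\mathscr{C}^{\log}$ the set of $q(\cdot)\in\mathscr{P}$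 for which there is a constant $C>0$ with $$\gamma\bigl(q_-(B_\gamma(x))-q_+(B_\gamma(x))\bigr)\le C\quad\text{and}\quad |q(x)-q(y)|\le\frac{C}{\log_p(p+\min\{|x|_p,|y|_p\})}$$ for all $\gamma\in\mathbb{Z}$ and $x,y\in\mathbb{Q}_p^n$. For $q(\cdot)\in\mathscr{P}$, $L^{q(\cdot)}$ is the space of measurable $f$ with $\int|f(x)/\eta|^{q(x)}dx<\infty$ for some $\eta>0$, with the norm $\|f\|_{L^{q(\cdot)}}=\inf\{\eta>0:\int|f(x)/\eta|^{q(x)}dx\le1\}$. For $0<\beta<1$, $\Lambda_\beta$ is the space of measurable real-valued $f$ with $\sup_{x\ne y}|f(x)-f(y)|/|x-y|_p^\beta<\infty$. Let $0<\beta<1$ and let $b$ be a locally integrable real-valued function on $\mathbb{Q}_p^n$. Call $(r(\cdot),q(\cdot))$ an admissible pair if $r(\cdot),q(\cdot)\in\mathscr{C}^{\log}$, $r_+<n/\beta$, and $1/q(\cdot)=1/r(\cdot)-\beta/n$. The following statements are equivalent: (1) $b\in\Lambda_\beta$ and $b\ge0$, that is, $b$ agrees almost everywhere with a nonnegative function in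 $\Lambda_\beta$. (2) $[b,\mathcal{M}^p]$ is bounded from $L^{r(\cdot)}$ to $L^{q(\cdot)}$ for every admissible pair, that is, for each such pair there is a constant $C$ such that, for every $f\in L^{r(\cdot)}$, the function $[b,\mathcal{M}^p](f)$ is well defined and finite almost everywhere, lies in $L^{q(\cdot)}$, and satisfies $\|[b,\mathcal{M}^p](f)\|_{L^{q(\cdot)}}\le C\|f\|_{L^{r(\cdot)}}$. (3) $[b,\mathcal{M}^p]$ is bounded from $L^{r(\cdot)}$ to $L^{q(\cdot)}$ for some admissible pair. (4) For some admissible pair, $$\sup_{\gamma\in\mathbb{Z},\,x\in\mathbb{Q}_p^n}\frac1{|B_\gamma(x)|_h^{\beta/n}}\,\frac{\bigl\|\bigl(b-\mathcal{M}^p_{B_\gamma(x)}(b)\bigr)\chi_{B_\gamma(x)}\bigr\|_{L^{q(\cdot)}}}{\|\chi_{B_\gamma(x)}\|_{L^{q(\cdot)}}}<\infty .$$ (5) The inequality in (4) holds for every admissible pair. -/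

import Mathlib

open MeasureTheory Metric
open scoped NNReal ENNReal

noncomputable section

namespace PadicLip

/-- The Borel sigma-algebra of the field of `p`-adic numbers. -/
instance instMeasurableSpacePadic (p : ℕ) [Fact p.Prime] : MeasurableSpace ℚ_[p] := borel ℚ_[p]

instance instBorelSpacePadic (p : ℕ) [Fact p.Prime] : BorelSpace ℚ_[p] := ⟨rfl⟩

/-- The space of `n`-tuples of `p`-adic numbers; its norm is the maximum of the `p`-adic absolute
values of the coordinates. -/
abbrev Space (p : ℕ) [Fact p.Prime] (n : ℕ) : Type := Fin n → ℚ_[p]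

variable {p : ℕ} [Fact p.Prime] {n : ℕ}

/-- The closed unit ball, as a compact set with non-empty interior. -/
def unitBall (p : ℕ) [Fact p.Prime] (n : ℕ) : TopologicalSpace.PositiveCompacts (Space p n) where
  carrier := closedBall 0 1
  isCompact' := isCompact_closedBall 0 1
  interior_nonempty' :=
    ⟨0, ball_subset_interior_closedBall (mem_ball_self one_pos)⟩

/-- The Haar measure, normalized so that the closed unit ball has measure one. -/
def haar (p : ℕ) [Fact p.Prime] (n : ℕ) : Measure (Space p n) :=
  Measure.addHaarMeasure (unitBall p n)

/-- The ball `B_γ(x)`: centre `x`, radius `p ^ γ`. -/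
def pBall (γ : ℤ) (x : Space p n) : Set (Space p n) := closedBall x ((p : ℝ) ^ γ)

/-! ### Maximal functions and the nonlinear commutator -/

/-- The mean of `|f|` over `B_γ(x)`, with values in `[0, ∞]`. -/
def avgAbs (f : Space p n → ℝ) (γ : ℤ) (x : Space p n) : ℝ≥0∞ :=
  (haar p n (pBall γ x))⁻¹ * ∫⁻ y in pBall γ x, ‖f y‖ₑ ∂haar p n

/-- The Hardy-Littlewood maximal function. -/
def maximal (f : Space p n → ℝ) (x : Space p n) : ℝ≥0∞ :=
  ⨆ γ : ℤ, avgAbs f γ x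

/-- The maximal function relative to a fixed ball `B`: only the balls inside `B` are used. -/
def maximalIn (B : Set (Space p n)) (f : Space p n → ℝ) (x : Space p n) : ℝ≥0∞ :=
  ⨆ (γ : ℤ) (_ : pBall γ x ⊆ B), avgAbs f γ x

/-- The nonlinear commutator `[b, M] f = b M f - M (b f)`, as an extended real number. In `EReal`
the difference `∞ - ∞` is `-∞`, so a point at which the commutator is not a well-defined real
number because `M (b f)` is infinite counts as a point at which it is infinite. -/
def commutator (b f : Space p n → ℝ) (x : Space p n) : EReal :=
  (b x : EReal) * (maximal f x : EReal) - (maximal (fun y => b y * f y) x : EReal)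

/-! ### Variable exponents -/

/-- `q_-(E)`, the essential infimum of `q` over `E`. -/
def expInf (q : Space p n → ℝ) (E : Set (Space p n)) : ℝ := essInf q ((haar p n).restrict E)

/-- `q_+(E)`, the essential supremum of `q` over `E`. -/
def expSup (q : Space p n → ℝ) (E : Set (Space p n)) : ℝ := essSup q ((haar p n).restrict E)

/-- The class of measurable exponents with `1 < q_- ≤ q(x) ≤ q_+ < ∞` for all `x`. Boundedness is
stated separately, so that `q_-` and `q_+` are the true essential bounds. -/
structure IsExponent (q : Space p n → ℝ) : Prop where
  measurable : Measurable q
  one_lt_inf : 1 < expInf q Set.univ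
  inf_le : ∀ x, expInf q Set.univ ≤ q x
  le_sup : ∀ x, q x ≤ expSup q Set.univ
  bounded : ∃ K : ℝ, ∀ x, |q x| ≤ K

/-- Global log-Hölder continuity: the local condition on balls together with the decay condition
at infinity. -/
structure IsLogHolder (q : Space p n → ℝ) : Prop where
  isExponent : IsExponent q
  local_bound : ∃ C : ℝ, 0 < C ∧ ∀ (γ : ℤ) (x : Space p n),
    (γ : ℝ) * (expInf q (pBall γ x) - expSup q (pBall γ x)) ≤ C
  decay : ∃ C : ℝ, 0 < C ∧ ∀ x y : Space p n,
    |q x - q y| ≤ C / Real.logb p (p + min ‖x‖ ‖y‖)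

/-- The pairs of exponents `r, q` with `r_+ < n / β` and `1 / q = 1 / r - β / n`. -/
structure IsAdmissiblePair (β : ℝ) (r q : Space p n → ℝ) : Prop where
  left : IsLogHolder r
  right : IsLogHolder q
  sup_lt : expSup r Set.univ < n / β
  eq : ∀ x, 1 / q x = 1 / r x - β / n

/-! ### Variable exponent Lebesgue spaces -/

/-- The modular `∫ |f(x) / η| ^ q(x) dx` of `f / η`. -/
def modular (q : Space p n → ℝ) (f : Space p n → EReal) (η : ℝ≥0) : ℝ≥0∞ :=
  ∫⁻ x, ((f x).abs / (η : ℝ≥0∞)) ^ q x ∂haar p n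

/-- The Luxemburg norm, infinite if no `η` is admissible. -/
def luxNorm (q : Space p n → ℝ) (f : Space p n → EReal) : ℝ≥0∞ :=
  ⨅ (η : ℝ≥0) (_ : 0 < η ∧ modular q f η ≤ 1), (η : ℝ≥0∞)

/-- Membership in the variable exponent Lebesgue space. Such a function is finite almost
everywhere. -/
def MemVarLp (q : Space p n → ℝ) (f : Space p n → EReal) : Prop :=
  AEMeasurable f (haar p n) ∧ ∃ η : ℝ≥0, 0 < η ∧ modular q f η < ∞

/-- The commutator `[b, M]` is bounded from the space with exponent `r` to the one with
exponent `q`. -/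
def CommutatorBounded (b : Space p n → ℝ) (r q : Space p n → ℝ) : Prop :=
  ∃ C : ℝ≥0, ∀ f : Space p n → ℝ, MemVarLp r (fun x => (f x : EReal)) →
    MemVarLp q (commutator b f) ∧
      luxNorm q (commutator b f) ≤ C * luxNorm r (fun x => (f x : EReal))

/-- The supremum over all balls `B` of
`|B| ^ (-β / n) * ‖(b - M_B b) χ_B‖ / ‖χ_B‖`, the norms being those with exponent `q`. -/
def oscillation (β : ℝ) (b : Space p n → ℝ) (q : Space p n → ℝ) : ℝ≥0∞ :=
  ⨆ (γ : ℤ) (x : Space p n),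
    (1 / haar p n (pBall γ x) ^ (β / n)) *
      (luxNorm q ((pBall γ x).indicator
          fun y => (b y : EReal) - (maximalIn (pBall γ x) b y : EReal)) /
        luxNorm q ((pBall γ x).indicator fun _ => (1 : EReal)))

/-! ### The Lipschitz space -/

/-- The homogeneous Lipschitz norm of order `β`. -/
def lipNorm (β : ℝ) (f : Space p n → ℝ) : ℝ≥0∞ :=
  ⨆ (x : Space p n) (y : Space p n) (_ : x ≠ y), ENNReal.ofReal (|f x - f y| / ‖x - y‖ ^ β)

/-- Membership in the homogeneous Lipschitz space of order `β`. -/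
def MemLip (β : ℝ) (f : Space p n → ℝ) : Prop :=
  Measurable f ∧ lipNorm β f < ∞

end PadicLip

end

/-!
Balls of a fixed radius partition `ℚ_[p] ^ n`, so averages over them are locally constant and the
maximal balls on which an average exceeds `t` are disjoint. This gives the weak type bound with
constant one, and from it the strong type bound. For variable exponents, split `f` at height one.
On balls of radius at most one the local log-Hölder condition makes the exponent effectively
constant for the large part. All remaining averages are bounded, and the decay condition lets one
compare the exponent with its limit at infinity. Hedberg's pointwise inequality then carries the
maximal theorem over to the fractional maximal operator `M_β`.

If `b ≥ 0` is Lipschitz of order `β`, then `|[b, M] f| ≤ L M_β f`, so the commutator is bounded.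
Conversely, on a ball `B` the commutator of `χ_B` is `b - M_B b`, so boundedness controls the
oscillation. By Hölder's inequality, in the form of the boundedness of `M` on the space with
exponent `q`, the oscillation bound gives `⨍_B |b - M_B b| ≤ K |B| ^ (β / n)`. As `M_B b ≥ ⨍_B |b|`
on `B`, this bounds both `⨍_B |b| - ⨍_B b`, whence `b ≥ 0` by Lebesgue differentiation, and the mean
oscillation of `b` over `B`, whence `b` is Lipschitz by Campanato's argument.
-/

noncomputable section

namespace PadicLip

variable {p : ℕ} [Fact p.Prime] {n : ℕ}

section LayerCake

variable {α : Type*} [MeasurableSpace α] {μ : Measure α} {F G : α → ℝ≥0∞} {s : ℝ}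

lemma setLIntegral_Ioi_rpow_eq_top (s : ℝ) :
    ∫⁻ t in Set.Ioi (0 : ℝ), ENNReal.ofReal (t ^ (s - 1)) = ∞ := by
  by_contra h
  refine not_integrableOn_Ioi_rpow (s - 1) ⟨by fun_prop, ?_⟩
  rw [hasFiniteIntegral_iff_ofReal]
  · exact lt_top_iff_ne_top.2 h
  · exact (ae_restrict_mem measurableSet_Ioi).mono fun t ht => Real.rpow_nonneg (le_of_lt ht) _

lemma lintegral_rpow_eq_lintegral_meas_lt (hF : AEMeasurable F μ) (hs : 0 < s) :
    ∫⁻ x, F x ^ s ∂μ = ENNReal.ofReal s *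
      ∫⁻ t in Set.Ioi (0 : ℝ), μ {x | ENNReal.ofReal t < F x} * ENNReal.ofReal (t ^ (s - 1)) := by
  by_cases hfin : ∀ᵐ x ∂μ, F x ≠ ∞
  · have hlayer := lintegral_rpow_eq_lintegral_meas_lt_mul μ (f := fun x => (F x).toReal)
      (.of_forall fun _ => ENNReal.toReal_nonneg) hF.ennreal_toReal hs
    calc ∫⁻ x, F x ^ s ∂μ = ∫⁻ x, ENNReal.ofReal ((F x).toReal ^ s) ∂μ := by
          refine lintegral_congr_ae (hfin.mono fun x hx => ?_)
          simp only
          rw [← ENNReal.ofReal_rpow_of_nonneg ENNReal.toReal_nonneg hs.le, ENNReal.ofReal_toReal hx]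
      _ = _ := by
          rw [hlayer]
          congr 1
          refine setLIntegral_congr_fun measurableSet_Ioi fun t ht => ?_
          congr 1
          refine measure_congr (hfin.mono fun x hx => ?_)
          exact propext (ENNReal.ofReal_lt_iff_lt_toReal (le_of_lt ht) hx).symm
  · have htop : μ {x | F x = ∞} ≠ 0 := by simpa [ae_iff] using hfin
    rw [lintegral_eq_top_of_measure_eq_top_ne_zero (hF.pow_const s)
      (by simpa [ENNReal.rpow_eq_top_iff, hs, hs.not_gt] using htop), eq_comm, eq_top_iff]
    calc ∞ = ENNReal.ofReal s * ∫⁻ t in Set.Ioi (0 : ℝ),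
          μ {x | F x = ∞} * ENNReal.ofReal (t ^ (s - 1)) := by
          rw [lintegral_const_mul _ (by fun_prop), setLIntegral_Ioi_rpow_eq_top,
            ENNReal.mul_top htop, ENNReal.mul_top (by simpa using hs)]
      _ ≤ _ := by
          gcongr with t x
          rintro hx
          simp [hx]

/-- Doob's argument: after integration in `t` the two sides of `h` are the layer cake formulas of
`G` for `μ` and of `F` for the measure with density `F`. -/
theorem lintegral_rpow_le_of_weak_type (hF : Measurable F) (hG : AEMeasurable G μ)
    (hs : 1 < s) (h : ∀ t : ℝ≥0∞, t * μ {x | t < G x} ≤ ∫⁻ x in {x | t < F x}, F x ∂μ) :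
    ∫⁻ x, G x ^ s ∂μ ≤ ENNReal.ofReal s * (ENNReal.ofReal (s - 1))⁻¹ * ∫⁻ x, F x ^ s ∂μ := by
  have hs₁ : 0 < s - 1 := sub_pos.2 hs
  have hlevel : ∀ t ∈ Set.Ioi (0 : ℝ), μ {x | ENNReal.ofReal t < G x} * ENNReal.ofReal (t ^ (s - 1))
      ≤ μ.withDensity F {x | ENNReal.ofReal t < F x} * ENNReal.ofReal (t ^ (s - 1 - 1)) := by
    intro t ht
    have hpow : t ^ (s - 1) = t * t ^ (s - 1 - 1) := by
      rw [Real.rpow_sub_one (ne_of_gt ht) (s - 1), mul_div_cancel₀ _ (ne_of_gt ht)]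
    rw [hpow, ENNReal.ofReal_mul (le_of_lt ht), ← mul_assoc, mul_comm (μ _),
      withDensity_apply _ (measurableSet_lt measurable_const hF)]
    gcongr
    exact h _
  calc ∫⁻ x, G x ^ s ∂μ = ENNReal.ofReal s * ∫⁻ t in Set.Ioi (0 : ℝ),
        μ {x | ENNReal.ofReal t < G x} * ENNReal.ofReal (t ^ (s - 1)) :=
        lintegral_rpow_eq_lintegral_meas_lt hG (one_pos.trans hs)
    _ ≤ ENNReal.ofReal s * ∫⁻ t in Set.Ioi (0 : ℝ),
        μ.withDensity F {x | ENNReal.ofReal t < F x} * ENNReal.ofReal (t ^ (s - 1 - 1)) := by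
        gcongr ENNReal.ofReal s * ?_
        exact setLIntegral_mono' measurableSet_Ioi hlevel
    _ = ENNReal.ofReal s * (ENNReal.ofReal (s - 1))⁻¹ * ∫⁻ x, F x ^ (s - 1) ∂μ.withDensity F := by
        rw [lintegral_rpow_eq_lintegral_meas_lt hF.aemeasurable hs₁, mul_assoc,
          ENNReal.inv_mul_cancel_left' (by simp [hs]) (by simp)]
    _ = _ := by
        rw [lintegral_withDensity_eq_lintegral_mul _ hF (hF.pow_const _)]
        congr 2 with x
        rw [Pi.mul_apply]
        nth_rw 1 [← ENNReal.rpow_one (F x)]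
        rw [← ENNReal.rpow_add_of_nonneg _ _ zero_le_one hs₁.le, add_sub_cancel]

lemma rpow_lintegral_le_lintegral_rpow [IsProbabilityMeasure μ] (hF : AEMeasurable F μ)
    (hs : 1 ≤ s) : (∫⁻ x, F x ∂μ) ^ s ≤ ∫⁻ x, F x ^ s ∂μ := by
  have hs₀ : 0 < s := one_pos.trans_le hs
  have h := eLpNorm'_le_eLpNorm'_of_exponent_le one_pos hs μ hF.aestronglyMeasurable
  rw [← ENNReal.le_rpow_inv_iff hs₀]
  simpa [eLpNorm'] using h

end LayerCake

/-! ### Balls -/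

lemma one_lt_prime_real (p : ℕ) [Fact p.Prime] : (1 : ℝ) < p := by
  exact_mod_cast (Fact.out : p.Prime).one_lt

lemma radius_pos (γ : ℤ) : (0 : ℝ) < (p : ℝ) ^ γ :=
  zpow_pos (one_pos.trans (one_lt_prime_real p)) γ

instance instIsAddHaarMeasureHaar : (haar p n).IsAddHaarMeasure := by
  unfold haar; infer_instance

lemma isOpen_pBall (γ : ℤ) (x : Space p n) : IsOpen (pBall γ x) :=
  IsUltrametricDist.isOpen_closedBall x (radius_pos γ).ne'

lemma measurableSet_pBall (γ : ℤ) (x : Space p n) : MeasurableSet (pBall γ x) :=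
  measurableSet_closedBall

lemma mem_pBall_self (γ : ℤ) (x : Space p n) : x ∈ pBall γ x :=
  mem_closedBall_self (radius_pos γ).le

lemma mem_pBall_comm {γ : ℤ} {x y : Space p n} : y ∈ pBall γ x ↔ x ∈ pBall γ y :=
  mem_closedBall_comm

lemma mem_pBall_iff_forall_norm_sub_le {γ : ℤ} {x y : Space p n} :
    y ∈ pBall γ x ↔ ∀ i, ‖y i - x i‖ ≤ (p : ℝ) ^ γ := by
  simp only [pBall, mem_closedBall, dist_eq_norm, pi_norm_le_iff_of_nonneg (radius_pos γ).le,
    Pi.sub_apply]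

lemma pBall_eq_of_mem {γ : ℤ} {x y : Space p n} (h : y ∈ pBall γ x) : pBall γ x = pBall γ y :=
  IsUltrametricDist.closedBall_eq_of_mem h

lemma pBall_mono {γ δ : ℤ} (h : γ ≤ δ) (x : Space p n) : pBall γ x ⊆ pBall δ x :=
  closedBall_subset_closedBall (zpow_le_zpow_right₀ (one_lt_prime_real p).le h)

lemma pBall_subset_of_mem {γ δ : ℤ} (h : γ ≤ δ) {x y : Space p n} (hy : y ∈ pBall δ x) :
    pBall γ y ⊆ pBall δ x := by
  rw [pBall_eq_of_mem hy]; exact pBall_mono h y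

lemma isOpen_of_forall_pBall_subset {γ : ℤ} {A : Set (Space p n)}
    (hA : ∀ x ∈ A, pBall γ x ⊆ A) : IsOpen A :=
  isOpen_iff_forall_mem_open.2 fun x hx =>
    ⟨pBall γ x, hA x hx, isOpen_pBall γ x, mem_pBall_self γ x⟩

lemma measurable_of_const_on_pBall {α : Type*} [TopologicalSpace α] [MeasurableSpace α]
    [BorelSpace α] {g : Space p n → α} (γ : ℤ)
    (h : ∀ x, ∀ y ∈ pBall γ x, g y = g x) : Measurable g := by
  refine (IsLocallyConstant.continuous ?_).measurable
  rw [IsLocallyConstant.iff_exists_open]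
  exact fun x => ⟨pBall γ x, isOpen_pBall γ x, mem_pBall_self γ x, h x⟩

lemma existsUnique_norm_sub_digit_lt_one {x : ℚ_[p]} (hx : ‖x‖ ≤ 1) :
    ∃! a : Fin p, ‖x - (a : ℕ)‖ < 1 := by
  obtain ⟨z, rfl⟩ : ∃ z : ℤ_[p], (z : ℚ_[p]) = x := ⟨⟨x, hx⟩, rfl⟩
  have hmem_iff : ∀ a : ℕ, z - a ∈ IsLocalRing.maximalIdeal ℤ_[p] ↔ ‖(z : ℚ_[p]) - a‖ < 1 := by
    intro a
    rw [IsLocalRing.mem_maximalIdeal, PadicInt.mem_nonunits, PadicInt.norm_def, PadicInt.coe_sub,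
      PadicInt.coe_natCast]
  obtain ⟨a, ⟨ha, hmem⟩, huniq⟩ := PadicInt.existsUnique_mem_range z
  exact ⟨⟨a, ha⟩, (hmem_iff a).1 hmem, fun b hb => Fin.ext (huniq b ⟨b.2, (hmem_iff b).2 hb⟩)⟩

lemma existsUnique_norm_sub_digit_le (γ : ℤ) {x : ℚ_[p]} (hx : ‖x‖ ≤ (p : ℝ) ^ (γ + 1)) :
    ∃! a : Fin p, ‖x - (p : ℚ_[p]) ^ (-(γ + 1)) * (a : ℕ)‖ ≤ (p : ℝ) ^ γ := by
  have hp : (p : ℚ_[p]) ≠ 0 := by exact_mod_cast (Fact.out : p.Prime).ne_zero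
  have hradius := radius_pos (p := p) (γ + 1)
  have hscale : ∀ y : ℚ_[p], ‖(p : ℚ_[p]) ^ (γ + 1) * y‖ = ((p : ℝ) ^ (γ + 1))⁻¹ * ‖y‖ := by
    intro y; rw [norm_mul, Padic.norm_p_zpow, zpow_neg]
  have hdigit := existsUnique_norm_sub_digit_lt_one (x := (p : ℚ_[p]) ^ (γ + 1) * x)
    (by rwa [hscale, inv_mul_le_iff₀ hradius, mul_one])
  refine (existsUnique_congr fun a => ?_).1 hdigit
  have hfactor : (p : ℚ_[p]) ^ (γ + 1) * x - (a : ℕ) =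
      (p : ℚ_[p]) ^ (γ + 1) * (x - (p : ℚ_[p]) ^ (-(γ + 1)) * (a : ℕ)) := by
    rw [mul_sub, ← mul_assoc, ← zpow_add₀ hp, add_neg_cancel, zpow_zero, one_mul]
  rw [hfactor, hscale, inv_mul_lt_iff₀ hradius, mul_one,
    ← Padic.norm_le_pow_iff_norm_lt_pow_add_one]

/-! ### The Haar measure of a ball -/

lemma haar_pBall_eq_haar_pBall_zero (γ : ℤ) (x : Space p n) :
    haar p n (pBall γ x) = haar p n (pBall γ 0) := by
  rw [pBall, pBall, Measure.addHaar_closedBall_center]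

/-- The centers of the `p ^ n` balls of radius `p ^ γ` that make up the ball of radius
`p ^ (γ + 1)` around the origin. -/
def digitCenter (γ : ℤ) (a : Fin n → Fin p) : Space p n :=
  fun i => (p : ℚ_[p]) ^ (-(γ + 1)) * ((a i : ℕ) : ℚ_[p])

lemma iUnion_pBall_digitCenter (γ : ℤ) :
    ⋃ a : Fin n → Fin p, pBall γ (digitCenter γ a) = pBall (γ + 1) 0 := by
  refine Set.Subset.antisymm (Set.iUnion_subset fun a => ?_) fun x hx => ?_
  · refine pBall_subset_of_mem (Int.le.intro 1 rfl) (mem_pBall_iff_forall_norm_sub_le.2 fun i => ?_)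
    have hdigit : ‖((a i : ℕ) : ℚ_[p])‖ ≤ 1 := by
      exact_mod_cast Padic.norm_int_le_one (p := p) ((a i : ℕ) : ℤ)
    simpa [digitCenter, Padic.norm_p_zpow] using
      mul_le_of_le_one_right (radius_pos (p := p) (γ + 1)).le hdigit
  · have hx' : ∀ i, ‖x i‖ ≤ (p : ℝ) ^ (γ + 1) := by
      simpa using mem_pBall_iff_forall_norm_sub_le.1 hx
    choose a ha using fun i => (existsUnique_norm_sub_digit_le γ (hx' i)).exists
    exact Set.mem_iUnion.2 ⟨a, mem_pBall_iff_forall_norm_sub_le.2 ha⟩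

lemma pairwise_disjoint_pBall_digitCenter (γ : ℤ) :
    Pairwise (Function.onFun Disjoint fun a : Fin n → Fin p => pBall γ (digitCenter γ a)) := by
  refine fun a b hab => Set.disjoint_left.2 fun x hxa hxb => hab (funext fun i => ?_)
  have hx : x ∈ pBall (γ + 1) (0 : Space p n) :=
    iUnion_pBall_digitCenter (p := p) γ ▸ Set.mem_iUnion_of_mem a hxa
  refine (existsUnique_norm_sub_digit_le γ (x := x i) ?_).unique
    (mem_pBall_iff_forall_norm_sub_le.1 hxa i) (mem_pBall_iff_forall_norm_sub_le.1 hxb i)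
  simpa using mem_pBall_iff_forall_norm_sub_le.1 hx i

lemma haar_pBall_add_one (γ : ℤ) :
    haar p n (pBall (γ + 1) 0) = (p : ℝ≥0∞) ^ n * haar p n (pBall γ 0) := by
  rw [← iUnion_pBall_digitCenter, measure_iUnion (pairwise_disjoint_pBall_digitCenter γ)
    fun a => measurableSet_pBall γ _]
  simp [haar_pBall_eq_haar_pBall_zero γ, tsum_fintype]

/-- The Haar measure of the balls of radius `p ^ γ`, see `haar_pBall`. -/
def vol (p n : ℕ) (γ : ℤ) : ℝ≥0∞ := (p : ℝ≥0∞) ^ ((n : ℝ) * γ)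

lemma prime_ne_zero (p : ℕ) [Fact p.Prime] : (p : ℝ≥0∞) ≠ 0 := by
  exact_mod_cast (Fact.out : p.Prime).ne_zero

lemma one_lt_prime (p : ℕ) [Fact p.Prime] : (1 : ℝ≥0∞) < p := by
  exact_mod_cast (Fact.out : p.Prime).one_lt

lemma vol_ne_zero (p : ℕ) [Fact p.Prime] (n : ℕ) (γ : ℤ) : vol p n γ ≠ 0 :=
  (ENNReal.rpow_pos (pos_iff_ne_zero.2 (prime_ne_zero p)) (ENNReal.natCast_ne_top p)).ne'

lemma vol_ne_top (p : ℕ) [Fact p.Prime] (n : ℕ) (γ : ℤ) : vol p n γ ≠ ∞ :=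
  ENNReal.rpow_ne_top_of_ne_zero (prime_ne_zero p) (ENNReal.natCast_ne_top p)

lemma vol_zero (p n : ℕ) : vol p n 0 = 1 := by simp [vol]

lemma vol_mono (p : ℕ) [Fact p.Prime] (n : ℕ) : Monotone (vol p n) := fun _ _ h =>
  ENNReal.rpow_le_rpow_of_exponent_le (one_lt_prime p).le
    (mul_le_mul_of_nonneg_left (by exact_mod_cast h) n.cast_nonneg)

lemma vol_le_one (p : ℕ) [Fact p.Prime] (n : ℕ) {γ : ℤ} (h : γ ≤ 0) : vol p n γ ≤ 1 :=
  vol_zero p n ▸ vol_mono p n h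

lemma one_le_vol (p : ℕ) [Fact p.Prime] (n : ℕ) {γ : ℤ} (h : 0 ≤ γ) : 1 ≤ vol p n γ :=
  vol_zero p n ▸ vol_mono p n h

lemma vol_rpow (p n : ℕ) (γ : ℤ) (t : ℝ) : vol p n γ ^ t = (p : ℝ≥0∞) ^ ((n : ℝ) * γ * t) := by
  rw [vol, ← ENNReal.rpow_mul]

lemma vol_rpow_ne_zero (p : ℕ) [Fact p.Prime] (n : ℕ) (γ : ℤ) (t : ℝ) : vol p n γ ^ t ≠ 0 :=
  (ENNReal.rpow_pos (pos_iff_ne_zero.2 (vol_ne_zero p n γ)) (vol_ne_top p n γ)).ne'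

lemma vol_rpow_ne_top (p : ℕ) [Fact p.Prime] (n : ℕ) (γ : ℤ) (t : ℝ) : vol p n γ ^ t ≠ ∞ :=
  ENNReal.rpow_ne_top_of_ne_zero (vol_ne_zero p n γ) (vol_ne_top p n γ)

lemma vol_add_one (p : ℕ) [Fact p.Prime] (n : ℕ) (γ : ℤ) :
    vol p n (γ + 1) = (p : ℝ≥0∞) ^ n * vol p n γ := by
  rw [vol, vol, ← ENNReal.rpow_natCast,
    ← ENNReal.rpow_add _ _ (prime_ne_zero p) (ENNReal.natCast_ne_top p)]
  push_cast
  ring_nf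

theorem haar_pBall (γ : ℤ) (x : Space p n) : haar p n (pBall γ x) = vol p n γ := by
  have hp : (p : ℝ≥0∞) ^ n ≠ 0 := pow_ne_zero _ (prime_ne_zero p)
  rw [haar_pBall_eq_haar_pBall_zero]
  induction γ with
  | zero =>
    have hunit : pBall 0 (0 : Space p n) = (unitBall p n : Set (Space p n)) := by
      rw [pBall, zpow_zero]; rfl
    rw [hunit, haar, Measure.addHaarMeasure_self, vol_zero]
  | succ i ih => rw [haar_pBall_add_one, ih, vol_add_one]
  | pred i ih =>
    rw [← ENNReal.mul_right_inj hp (ENNReal.pow_ne_top (ENNReal.natCast_ne_top p)),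
      ← haar_pBall_add_one, ← vol_add_one, sub_add_cancel, ih]

/-! ### Averages over balls -/

/-- The normalized Haar measure of a ball, with respect to which all averages are taken. -/
def ballMeasure (γ : ℤ) (x : Space p n) : Measure (Space p n) :=
  ProbabilityTheory.cond (haar p n) (pBall γ x)

lemma ballMeasure_eq (γ : ℤ) (x : Space p n) :
    ballMeasure γ x = (vol p n γ)⁻¹ • (haar p n).restrict (pBall γ x) := by
  rw [ballMeasure, ProbabilityTheory.cond, haar_pBall]

instance instIsProbabilityMeasureBallMeasure (γ : ℤ) (x : Space p n) :
    IsProbabilityMeasure (ballMeasure γ x) :=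
  ProbabilityTheory.cond_isProbabilityMeasure_of_finite (by simp [haar_pBall, vol_ne_zero])
    (by simp [haar_pBall, vol_ne_top])

lemma ballMeasure_eq_of_mem {γ : ℤ} {x y : Space p n} (h : y ∈ pBall γ x) :
    ballMeasure γ y = ballMeasure γ x := by
  rw [ballMeasure, ballMeasure, pBall_eq_of_mem h]

lemma ballMeasure_absolutelyContinuous (γ : ℤ) (x : Space p n) : ballMeasure γ x ≪ haar p n :=
  ProbabilityTheory.cond_absolutelyContinuous

lemma ae_mem_pBall_ballMeasure (γ : ℤ) (x : Space p n) :
    ∀ᵐ y ∂ballMeasure γ x, y ∈ pBall γ x :=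
  ProbabilityTheory.ae_cond_mem (measurableSet_pBall γ x)

lemma ae_ballMeasure_of_ae {P : Space p n → Prop} {γ : ℤ} {x : Space p n}
    (h : ∀ᵐ y ∂haar p n, y ∈ pBall γ x → P y) : ∀ᵐ y ∂ballMeasure γ x, P y := by
  filter_upwards [(ballMeasure_absolutelyContinuous γ x).ae_le h, ae_mem_pBall_ballMeasure γ x]
    with y hP hy using hP hy

/-- The mean of a nonnegative function over a ball. -/
def avg (F : Space p n → ℝ≥0∞) (γ : ℤ) (x : Space p n) : ℝ≥0∞ :=
  ∫⁻ y, F y ∂ballMeasure γ x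

lemma avg_eq (F : Space p n → ℝ≥0∞) (γ : ℤ) (x : Space p n) :
    avg F γ x = (vol p n γ)⁻¹ * ∫⁻ y in pBall γ x, F y ∂haar p n := by
  rw [avg, ballMeasure_eq, lintegral_smul_measure, smul_eq_mul]

lemma avg_eq_of_mem (F : Space p n → ℝ≥0∞) {γ : ℤ} {x y : Space p n} (h : y ∈ pBall γ x) :
    avg F γ y = avg F γ x := by
  rw [avg, avg, ballMeasure_eq_of_mem h]

lemma measurable_avg (F : Space p n → ℝ≥0∞) (γ : ℤ) : Measurable (avg F γ) :=
  measurable_of_const_on_pBall γ fun _ _ h => avg_eq_of_mem F h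

lemma avg_mono_on {F G : Space p n → ℝ≥0∞} {γ : ℤ} {x : Space p n}
    (h : ∀ᵐ y ∂haar p n, y ∈ pBall γ x → F y ≤ G y) : avg F γ x ≤ avg G γ x :=
  lintegral_mono_ae (ae_ballMeasure_of_ae h)

lemma avg_mono {F G : Space p n → ℝ≥0∞} (h : ∀ y, F y ≤ G y) (γ : ℤ) (x : Space p n) :
    avg F γ x ≤ avg G γ x :=
  lintegral_mono h

lemma avg_congr_on {F G : Space p n → ℝ≥0∞} {γ : ℤ} {x : Space p n}
    (h : ∀ᵐ y ∂haar p n, y ∈ pBall γ x → F y = G y) : avg F γ x = avg G γ x :=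
  lintegral_congr_ae (ae_ballMeasure_of_ae h)

lemma avg_const (c : ℝ≥0∞) (γ : ℤ) (x : Space p n) : avg (fun _ => c) γ x = c := by
  rw [avg, lintegral_const, measure_univ, mul_one]

lemma avg_le_of_le {F : Space p n → ℝ≥0∞} {c : ℝ≥0∞} {γ : ℤ} {x : Space p n}
    (h : ∀ᵐ y ∂haar p n, y ∈ pBall γ x → F y ≤ c) : avg F γ x ≤ c :=
  (avg_mono_on h).trans (avg_const c γ x).le

lemma avg_add {F : Space p n → ℝ≥0∞} (hF : Measurable F) (G : Space p n → ℝ≥0∞)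
    (γ : ℤ) (x : Space p n) : avg (fun y => F y + G y) γ x = avg F γ x + avg G γ x :=
  lintegral_add_left hF G

lemma avg_const_mul {c : ℝ≥0∞} (hc : c ≠ ∞) (F : Space p n → ℝ≥0∞) (γ : ℤ) (x : Space p n) :
    avg (fun y => c * F y) γ x = c * avg F γ x :=
  lintegral_const_mul' c F hc

lemma avg_le_vol_inv_mul (F : Space p n → ℝ≥0∞) (γ : ℤ) (x : Space p n) :
    avg F γ x ≤ (vol p n γ)⁻¹ * ∫⁻ y, F y ∂haar p n := by
  rw [avg_eq]; gcongr; exact Measure.restrict_le_self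

lemma avg_rpow_le {F : Space p n → ℝ≥0∞} (hF : Measurable F) {s : ℝ} (hs : 1 ≤ s)
    (γ : ℤ) (x : Space p n) : avg F γ x ^ s ≤ avg (fun y => F y ^ s) γ x :=
  rpow_lintegral_le_lintegral_rpow hF.aemeasurable hs

lemma avg_le_lintegral_rpow_mul_vol_rpow {F : Space p n → ℝ≥0∞} (hF : Measurable F) {s : ℝ}
    (hs : 1 ≤ s) (γ : ℤ) (x : Space p n) :
    avg F γ x ≤ (∫⁻ y, F y ^ s ∂haar p n) ^ (1 / s) * vol p n γ ^ (-(1 / s)) := by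
  have hs₀ : 0 < s := one_pos.trans_le hs
  have h := (avg_rpow_le hF hs γ x).trans (avg_le_vol_inv_mul _ γ x)
  rwa [ENNReal.rpow_neg, ← ENNReal.inv_rpow, ← ENNReal.mul_rpow_of_nonneg _ _ (by positivity),
    one_div, ENNReal.le_rpow_inv_iff hs₀, mul_comm]

lemma lintegral_avg {F : Space p n → ℝ≥0∞} (hF : Measurable F) (γ : ℤ) :
    ∫⁻ x, avg F γ x ∂haar p n = ∫⁻ x, F x ∂haar p n := by
  have hkernel : MeasurableSet {z : Space p n × Space p n | z.2 ∈ pBall γ z.1} :=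
    (isClosed_le (continuous_snd.dist continuous_fst) continuous_const).measurableSet
  have hmeas : Measurable fun z : Space p n × Space p n => (pBall γ z.1).indicator F z.2 :=
    (hF.comp measurable_snd).indicator hkernel
  have hsymm : ∀ x y : Space p n,
      (pBall γ x).indicator F y = (pBall γ y).indicator (fun _ => F y) x := fun x y => by
    classical simp only [Set.indicator_apply, mem_pBall_comm (x := x)]
  calc ∫⁻ x, avg F γ x ∂haar p n
      = (vol p n γ)⁻¹ * ∫⁻ x, ∫⁻ y, (pBall γ x).indicator F y ∂haar p n ∂haar p n := by
        simp_rw [avg_eq, lintegral_indicator (measurableSet_pBall γ _)]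
        exact lintegral_const_mul' _ _ (ENNReal.inv_ne_top.2 (vol_ne_zero p n γ))
    _ = (vol p n γ)⁻¹ * ∫⁻ y, ∫⁻ x, (pBall γ y).indicator (fun _ => F y) x ∂haar p n ∂haar p n := by
        rw [lintegral_lintegral_swap hmeas.aemeasurable]
        simp_rw [hsymm]
    _ = (vol p n γ)⁻¹ * ∫⁻ y, vol p n γ * F y ∂haar p n := by
        simp_rw [lintegral_indicator_const (measurableSet_pBall γ _), haar_pBall, mul_comm]
    _ = ∫⁻ y, F y ∂haar p n := by
        rw [lintegral_const_mul _ hF,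
          ENNReal.inv_mul_cancel_left (vol_ne_zero p n γ) (vol_ne_top p n γ)]

lemma avg_indicator {γ : ℤ} {A : Set (Space p n)} (hA : ∀ x ∈ A, pBall γ x ⊆ A)
    (F : Space p n → ℝ≥0∞) : avg (A.indicator F) γ = A.indicator (avg F γ) := by
  ext x
  by_cases hx : x ∈ A
  · rw [Set.indicator_of_mem hx]
    exact avg_congr_on (.of_forall fun y hy => Set.indicator_of_mem (hA x hx hy) F)
  · rw [Set.indicator_of_notMem hx, ← avg_const 0 γ x]
    exact avg_congr_on (.of_forall fun y hy =>
      Set.indicator_of_notMem (fun hyA => hx (hA y hyA (mem_pBall_comm.1 hy))) F)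

lemma setLIntegral_avg {F : Space p n → ℝ≥0∞} (hF : Measurable F) {γ : ℤ}
    {A : Set (Space p n)} (hA : ∀ x ∈ A, pBall γ x ⊆ A) :
    ∫⁻ x in A, avg F γ x ∂haar p n = ∫⁻ x in A, F x ∂haar p n := by
  have hAm := (isOpen_of_forall_pBall_subset hA).measurableSet
  rw [← lintegral_indicator hAm, ← avg_indicator hA, lintegral_avg (hF.indicator hAm),
    lintegral_indicator hAm]

lemma avg_avg {F : Space p n → ℝ≥0∞} (hF : Measurable F) {γ δ : ℤ} (h : γ ≤ δ)
    (x : Space p n) : avg (avg F γ) δ x = avg F δ x := by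
  rw [avg_eq, setLIntegral_avg hF fun y hy => pBall_subset_of_mem h hy, avg_eq]

/-! ### Maximal functions -/

/-- The Hardy-Littlewood maximal function of a nonnegative function. -/
def maxFn (F : Space p n → ℝ≥0∞) (x : Space p n) : ℝ≥0∞ := ⨆ γ : ℤ, avg F γ x

/-- The fractional maximal function of order `n α` of a nonnegative function. -/
def fracMax (α : ℝ) (F : Space p n → ℝ≥0∞) (x : Space p n) : ℝ≥0∞ :=
  ⨆ γ : ℤ, vol p n γ ^ α * avg F γ x

lemma fracMax_zero (F : Space p n → ℝ≥0∞) : fracMax 0 F = maxFn F := by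
  ext x; simp [fracMax, maxFn]

lemma avg_le_maxFn (F : Space p n → ℝ≥0∞) (γ : ℤ) (x : Space p n) : avg F γ x ≤ maxFn F x :=
  le_iSup (fun γ => avg F γ x) γ

lemma vol_rpow_mul_avg_le_fracMax (α : ℝ) (F : Space p n → ℝ≥0∞) (γ : ℤ) (x : Space p n) :
    vol p n γ ^ α * avg F γ x ≤ fracMax α F x :=
  le_iSup (fun γ => vol p n γ ^ α * avg F γ x) γ

lemma measurable_maxFn (F : Space p n → ℝ≥0∞) : Measurable (maxFn F) :=
  Measurable.iSup fun γ => measurable_avg F γ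

lemma measurable_fracMax (α : ℝ) (F : Space p n → ℝ≥0∞) : Measurable (fracMax α F) :=
  Measurable.iSup fun γ => (measurable_avg F γ).const_mul _

lemma fracMax_congr_ae {F G : Space p n → ℝ≥0∞} (h : F =ᵐ[haar p n] G) (α : ℝ) :
    fracMax α F = fracMax α G := by
  ext x
  simp only [fracMax, fun γ => avg_congr_on (γ := γ) (x := x) (h.mono fun _ h _ => h)]

lemma fracMax_const_mul {c : ℝ≥0∞} (hc : c ≠ ∞) (α : ℝ) (F : Space p n → ℝ≥0∞)
    (x : Space p n) : fracMax α (fun y => c * F y) x = c * fracMax α F x := by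
  simp only [fracMax, avg_const_mul hc, ENNReal.mul_iSup, mul_left_comm]

/-- The points at which `p ^ γ` is the largest radius, among those at most `p ^ N`, of a ball over
which the average of `F` exceeds `t`. Balls of equal radius are equal or disjoint, so this set is
a union of balls of radius `p ^ γ`. -/
def maximalRadiusSet (F : Space p n → ℝ≥0∞) (t : ℝ≥0∞) (N γ : ℤ) : Set (Space p n) :=
  {x | γ ≤ N ∧ t < avg F γ x ∧ ∀ δ, γ < δ → δ ≤ N → avg F δ x ≤ t}

lemma pBall_subset_maximalRadiusSet {F : Space p n → ℝ≥0∞} {t : ℝ≥0∞} {N γ : ℤ} {x : Space p n}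
    (hx : x ∈ maximalRadiusSet F t N γ) : pBall γ x ⊆ maximalRadiusSet F t N γ := by
  obtain ⟨hγ, hlt, hmax⟩ := hx
  refine fun y hy => ⟨hγ, (avg_eq_of_mem F hy).symm ▸ hlt, fun δ hδ hδN => ?_⟩
  rw [avg_eq_of_mem F (pBall_mono hδ.le x hy)]
  exact hmax δ hδ hδN

lemma measurableSet_maximalRadiusSet (F : Space p n → ℝ≥0∞) (t : ℝ≥0∞) (N γ : ℤ) :
    MeasurableSet (maximalRadiusSet F t N γ) :=
  (isOpen_of_forall_pBall_subset fun _ => pBall_subset_maximalRadiusSet).measurableSet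

lemma pairwise_disjoint_maximalRadiusSet (F : Space p n → ℝ≥0∞) (t : ℝ≥0∞) (N : ℤ) :
    Pairwise (Function.onFun Disjoint (maximalRadiusSet F t N)) := by
  refine (pairwise_disjoint_on _).2 fun γ δ hγδ => Set.disjoint_left.2 ?_
  rintro x ⟨-, -, hmax⟩ ⟨hδ, hlt, -⟩
  exact (hmax δ hγδ hδ).not_gt hlt

lemma iUnion_maximalRadiusSet (F : Space p n → ℝ≥0∞) (t : ℝ≥0∞) (N : ℤ) :
    ⋃ γ, maximalRadiusSet F t N γ = {x | ∃ γ ≤ N, t < avg F γ x} := by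
  ext x
  simp only [Set.mem_iUnion, Set.mem_ofPred_eq]
  constructor
  · rintro ⟨γ, hγ, hlt, -⟩
    exact ⟨γ, hγ, hlt⟩
  · intro hex
    obtain ⟨δ, ⟨hδ, hlt⟩, hmax⟩ := Int.exists_greatest_of_bdd
      (P := fun γ => γ ≤ N ∧ t < avg F γ x) ⟨N, fun γ hγ => hγ.1⟩ hex
    exact ⟨δ, hδ, hlt, fun ε hδε hε => not_lt.1 fun h => (hmax ε ⟨hε, h⟩).not_gt hδε⟩

lemma mul_haar_exists_lt_avg_le {F : Space p n → ℝ≥0∞} (hF : Measurable F) (t : ℝ≥0∞) (N : ℤ) :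
    t * haar p n {x | ∃ γ ≤ N, t < avg F γ x} ≤ ∫⁻ x, F x ∂haar p n := by
  have hmeas := measurableSet_maximalRadiusSet F t N
  have hdisj := pairwise_disjoint_maximalRadiusSet F t N
  rw [← iUnion_maximalRadiusSet, measure_iUnion hdisj hmeas, ← ENNReal.tsum_mul_left]
  calc ∑' γ, t * haar p n (maximalRadiusSet F t N γ)
      ≤ ∑' γ, ∫⁻ x in maximalRadiusSet F t N γ, F x ∂haar p n := by
        refine ENNReal.tsum_le_tsum fun γ => ?_
        rw [← setLIntegral_avg hF fun _ => pBall_subset_maximalRadiusSet, ← setLIntegral_const]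
        exact setLIntegral_mono' (hmeas γ) fun x hx => hx.2.1.le
    _ = ∫⁻ x in ⋃ γ, maximalRadiusSet F t N γ, F x ∂haar p n :=
        (lintegral_iUnion hmeas hdisj _).symm
    _ ≤ ∫⁻ x, F x ∂haar p n := setLIntegral_le_lintegral _ _

theorem mul_haar_lt_maxFn_le {F : Space p n → ℝ≥0∞} (hF : Measurable F) (t : ℝ≥0∞) :
    t * haar p n {x | t < maxFn F x} ≤ ∫⁻ x, F x ∂haar p n := by
  have hunion : {x | t < maxFn F x} = ⋃ N : ℤ, {x | ∃ γ ≤ N, t < avg F γ x} := by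
    ext x
    simp only [maxFn, lt_iSup_iff, Set.mem_iUnion, Set.mem_ofPred_eq]
    exact ⟨fun ⟨γ, h⟩ => ⟨γ, γ, le_rfl, h⟩, fun ⟨_, γ, _, h⟩ => ⟨γ, h⟩⟩
  have hmono : Monotone fun N : ℤ => {x : Space p n | ∃ γ ≤ N, t < avg F γ x} :=
    fun N M h x ⟨γ, hγ, hlt⟩ => ⟨γ, hγ.trans h, hlt⟩
  rw [hunion, hmono.measure_iUnion, ENNReal.mul_iSup]
  exact iSup_le fun N => mul_haar_exists_lt_avg_le hF t N

lemma maxFn_le_maxFn_indicator_add {F : Space p n → ℝ≥0∞} (hF : Measurable F) (c : ℝ≥0∞)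
    (x : Space p n) : maxFn F x ≤ maxFn ({y | c < F y}.indicator F) x + c := by
  have hm : MeasurableSet {y | c < F y} := measurableSet_lt measurable_const hF
  refine iSup_le fun γ => ?_
  calc avg F γ x ≤ avg (fun y => {y | c < F y}.indicator F y + c) γ x := by
        refine avg_mono (fun y => ?_) γ x
        by_cases hy : c < F y
        · exact (Set.indicator_of_mem (s := {y | c < F y}) hy F).symm ▸ le_self_add
        · exact (not_lt.1 hy).trans le_add_self
    _ = avg ({y | c < F y}.indicator F) γ x + c := by
        rw [avg_add (hF.indicator hm), avg_const]
    _ ≤ _ := by gcongr; exact avg_le_maxFn _ γ x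

lemma mul_haar_lt_maxFn_le_setLIntegral {F : Space p n → ℝ≥0∞} (hF : Measurable F) (t : ℝ≥0∞) :
    t * haar p n {x | t < maxFn F x} ≤ ∫⁻ x in {x | t < 2 * F x}, 2 * F x ∂haar p n := by
  have hlevel : {x | t < 2 * F x} = {x | t / 2 < F x} := by
    ext x
    simp only [Set.mem_ofPred_eq]
    rw [ENNReal.div_lt_iff (.inl two_ne_zero) (.inl ENNReal.ofNat_ne_top), mul_comm]
  have hm : MeasurableSet {x | t / 2 < F x} := measurableSet_lt measurable_const hF
  have hsub : {x | t < maxFn F x} ⊆ {x | t / 2 < maxFn ({y | t / 2 < F y}.indicator F) x} := by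
    refine fun x hx => Set.mem_ofPred.2 (lt_of_not_ge fun hle => ?_)
    refine not_le.2 hx ((maxFn_le_maxFn_indicator_add hF (t / 2) x).trans ?_)
    exact (add_le_add_left hle (t / 2)).trans_eq (ENNReal.add_halves t)
  calc t * haar p n {x | t < maxFn F x}
      ≤ t * haar p n {x | t / 2 < maxFn ({y | t / 2 < F y}.indicator F) x} := by gcongr
    _ = 2 * (t / 2 * haar p n {x | t / 2 < maxFn ({y | t / 2 < F y}.indicator F) x}) := by
        rw [← mul_assoc, ENNReal.mul_div_cancel two_ne_zero ENNReal.ofNat_ne_top]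
    _ ≤ 2 * ∫⁻ x, {y | t / 2 < F y}.indicator F x ∂haar p n := by
        gcongr; exact mul_haar_lt_maxFn_le (hF.indicator hm) _
    _ = ∫⁻ x in {x | t < 2 * F x}, 2 * F x ∂haar p n := by
        rw [lintegral_indicator hm, hlevel, lintegral_const_mul _ hF]

theorem exists_lintegral_maxFn_rpow_le (p : ℕ) [Fact p.Prime] (n : ℕ) {s : ℝ} (hs : 1 < s) :
    ∃ C : ℝ≥0∞, C ≠ ∞ ∧ ∀ F : Space p n → ℝ≥0∞, Measurable F →
      ∫⁻ x, maxFn F x ^ s ∂haar p n ≤ C * ∫⁻ x, F x ^ s ∂haar p n := by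
  have hs₀ : 0 ≤ s := (one_pos.trans hs).le
  refine ⟨ENNReal.ofReal s * (ENNReal.ofReal (s - 1))⁻¹ * 2 ^ s, ?_, fun F hF => ?_⟩
  · have hinv : (ENNReal.ofReal (s - 1))⁻¹ ≠ ∞ := by simpa using hs
    finiteness
  · refine (lintegral_rpow_le_of_weak_type (hF.const_mul 2) (measurable_maxFn F).aemeasurable hs
      (mul_haar_lt_maxFn_le_setLIntegral hF)).trans_eq ?_
    simp_rw [ENNReal.mul_rpow_of_nonneg _ _ hs₀]
    rw [lintegral_const_mul _ (hF.pow_const s), ← mul_assoc]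

/-- Hedberg's estimate. -/
lemma fracMax_rpow_le {F : Space p n → ℝ≥0∞} (hF : Measurable F) {α r q : ℝ}
    (hα : 0 ≤ α) (hr : 1 ≤ r) (hq : 0 < q) (hrq : 1 / q = 1 / r - α) (x : Space p n) :
    fracMax α F x ^ q ≤ (∫⁻ y, F y ^ r ∂haar p n) ^ (α * q) * maxFn F x ^ r := by
  have hr₀ : 0 < r := by linarith
  set A := ∫⁻ y, F y ^ r ∂haar p n
  have hle : r / q ≤ 1 := by
    rw [div_le_one hq, ← one_div_le_one_div hq hr₀]; linarith
  have hα_eq : 1 / r * (1 - r / q) = α := by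
    rw [show α = 1 / r - 1 / q by linarith]; field_simp
  have hpointwise : fracMax α F x ≤ A ^ α * maxFn F x ^ (r / q) := by
    refine iSup_le fun γ => ?_
    have hcancel : vol p n γ ^ α * vol p n γ ^ (-α) = 1 := by
      rw [← ENNReal.rpow_add _ _ (vol_ne_zero p n γ) (vol_ne_top p n γ), add_neg_cancel,
        ENNReal.rpow_zero]
    calc vol p n γ ^ α * avg F γ x
        = vol p n γ ^ α * (avg F γ x ^ (r / q) * avg F γ x ^ (1 - r / q)) := by
          rw [← ENNReal.rpow_add_of_nonneg _ _ (by positivity) (by linarith), add_sub_cancel,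
            ENNReal.rpow_one]
      _ ≤ vol p n γ ^ α * (maxFn F x ^ (r / q) *
          (A ^ (1 / r) * vol p n γ ^ (-(1 / r))) ^ (1 - r / q)) := by
          gcongr
          · exact avg_le_maxFn F γ x
          · exact avg_le_lintegral_rpow_mul_vol_rpow hF hr γ x
      _ = (vol p n γ ^ α * vol p n γ ^ (-α)) * (A ^ α * maxFn F x ^ (r / q)) := by
          rw [ENNReal.mul_rpow_of_nonneg _ _ (by linarith), ← ENNReal.rpow_mul,
            ← ENNReal.rpow_mul, neg_mul, hα_eq]
          ring
      _ = A ^ α * maxFn F x ^ (r / q) := by rw [hcancel, one_mul]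
  calc fracMax α F x ^ q ≤ (A ^ α * maxFn F x ^ (r / q)) ^ q := by gcongr
    _ = A ^ (α * q) * maxFn F x ^ r := by
      rw [ENNReal.mul_rpow_of_nonneg _ _ hq.le, ← ENNReal.rpow_mul, ← ENNReal.rpow_mul,
        div_mul_cancel₀ _ hq.ne']

lemma fracMax_le_max {F : Space p n → ℝ≥0∞} (hF : Measurable F) {α r : ℝ}
    (hα : 0 ≤ α) (hr : 1 ≤ r) (hαr : α ≤ 1 / r) {K : ℝ≥0∞} (hK : ∀ x, F x ≤ K) (x : Space p n) :
    fracMax α F x ≤ max K ((∫⁻ y, F y ^ r ∂haar p n) ^ (1 / r)) := by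
  refine iSup_le fun γ => ?_
  rcases le_total γ 0 with hγ | hγ
  · refine le_max_of_le_left ?_
    calc vol p n γ ^ α * avg F γ x ≤ 1 * K := by
          gcongr
          · exact ENNReal.rpow_le_one (vol_le_one p n hγ) hα
          · exact avg_le_of_le (.of_forall fun y _ => hK y)
      _ = K := one_mul K
  · refine le_max_of_le_right ?_
    set A := ∫⁻ y, F y ^ r ∂haar p n
    calc vol p n γ ^ α * avg F γ x
        ≤ vol p n γ ^ (1 / r) * (A ^ (1 / r) * vol p n γ ^ (-(1 / r))) := by
          gcongr
          · exact one_le_vol p n hγ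
          · exact avg_le_lintegral_rpow_mul_vol_rpow hF hr γ x
      _ = A ^ (1 / r) := by
          rw [mul_left_comm, ← ENNReal.rpow_add _ _ (vol_ne_zero p n γ) (vol_ne_top p n γ),
            add_neg_cancel, ENNReal.rpow_zero, mul_one]

/-! ### Variable exponents -/

lemma IsExponent.one_lt {q : Space p n → ℝ} (hq : IsExponent q) (x : Space p n) : 1 < q x :=
  hq.one_lt_inf.trans_le (hq.inf_le x)

lemma IsExponent.ae_mem_Icc {q : Space p n → ℝ} (hq : IsExponent q) (γ : ℤ) (x : Space p n) :
    ∀ᵐ y ∂haar p n, y ∈ pBall γ x →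
      q y ∈ Set.Icc (expInf q (pBall γ x)) (expSup q (pBall γ x)) := by
  obtain ⟨K, hK⟩ := hq.bounded
  have hinf : ∀ᵐ y ∂(haar p n).restrict (pBall γ x), expInf q (pBall γ x) ≤ q y :=
    ae_essInf_le (Filter.isBoundedUnder_of ⟨-K, fun y => (abs_le.1 (hK y)).1⟩)
  have hsup : ∀ᵐ y ∂(haar p n).restrict (pBall γ x), q y ≤ expSup q (pBall γ x) :=
    ae_le_essSup (Filter.isBoundedUnder_of ⟨K, fun y => (abs_le.1 (hK y)).2⟩)
  exact (ae_restrict_iff' (measurableSet_pBall γ x)).1 (hinf.and hsup)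

lemma IsExponent.ae_forall_mem_Icc {q : Space p n → ℝ} (hq : IsExponent q) :
    ∀ᵐ x ∂haar p n, ∀ γ : ℤ, q x ∈ Set.Icc (expInf q (pBall γ x)) (expSup q (pBall γ x)) := by
  let u := TopologicalSpace.denseSeq (Space p n)
  have hdense : ∀ᵐ x ∂haar p n, ∀ (γ : ℤ) (i : ℕ), x ∈ pBall γ (u i) →
      q x ∈ Set.Icc (expInf q (pBall γ (u i))) (expSup q (pBall γ (u i))) :=
    ae_all_iff.2 fun γ => ae_all_iff.2 fun i => hq.ae_mem_Icc γ (u i)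
  filter_upwards [hdense] with x hx γ
  obtain ⟨i, hi⟩ := (TopologicalSpace.denseRange_denseSeq (Space p n)).exists_mem_open
    (isOpen_pBall γ x) ⟨x, mem_pBall_self γ x⟩
  rw [pBall_eq_of_mem hi]
  exact hx γ i (mem_pBall_comm.1 hi)

lemma IsExponent.inf_le_expInf {q : Space p n → ℝ} (hq : IsExponent q) (γ : ℤ) (x : Space p n) :
    expInf q Set.univ ≤ expInf q (pBall γ x) := by
  obtain ⟨K, hK⟩ := hq.bounded
  have hne : (ae ((haar p n).restrict (pBall γ x))).NeBot := by
    rw [ae_neBot, Ne, Measure.restrict_eq_zero, haar_pBall]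
    exact vol_ne_zero p n γ
  have hbdd : (ae ((haar p n).restrict (pBall γ x))).IsBoundedUnder (· ≤ ·) q :=
    Filter.isBoundedUnder_of ⟨K, fun y => (abs_le.1 (hK y)).2⟩
  exact le_essInf_of_ae_le _ (.of_forall hq.inf_le) hbdd.isCoboundedUnder_ge

/-- The logarithmic size `log_p (p + |x|)`, the scale on which the decay condition for exponents is
measured. -/
def logSize (x : Space p n) : ℝ := Real.logb p (p + ‖x‖)

lemma one_le_logSize (x : Space p n) : 1 ≤ logSize x := by
  have hp := one_lt_prime_real p
  rw [logSize, Real.le_logb_iff_rpow_le hp (by positivity), Real.rpow_one]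
  exact le_add_of_nonneg_right (norm_nonneg x)

lemma rpow_logSize (x : Space p n) : (p : ℝ) ^ logSize x = p + ‖x‖ := by
  have hp := one_lt_prime_real p
  exact Real.rpow_logb (one_pos.trans hp) hp.ne' (by positivity)

lemma tendsto_logSize_cobounded :
    Filter.Tendsto (logSize : Space p n → ℝ) (Bornology.cobounded _) Filter.atTop :=
  (Real.tendsto_logb_atTop (one_lt_prime_real p)).comp
    (Filter.tendsto_atTop_add_const_left _ _ tendsto_norm_cobounded_atTop)

open Filter Topology in
lemma IsLogHolder.exists_limit [NeZero n] {q : Space p n → ℝ} (hq : IsLogHolder q) :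
    ∃ Q C : ℝ, 1 < Q ∧ 0 < C ∧ (∀ x, |q x - Q| ≤ C / logSize x) ∧
      Tendsto q (Bornology.cobounded _) (𝓝 Q) := by
  obtain ⟨C, hC, hdecay⟩ := hq.decay
  obtain ⟨K, hK⟩ := hq.isExponent.bounded
  have : (Bornology.cobounded (Space p n)).NeBot := NormedSpace.cobounded_neBot ℚ_[p] _
  let U := Ultrafilter.of (Bornology.cobounded (Space p n))
  obtain ⟨Q, hQ, hlim⟩ := (isCompact_Icc (a := expInf q Set.univ) (b := K)).ultrafilter_le_nhds
    (U.map q) (tendsto_principal.2 <| .of_forall fun x =>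
      ⟨hq.isExponent.inf_le x, (abs_le.1 (hK x)).2⟩)
  have hbound : ∀ x, |q x - Q| ≤ C / logSize x := fun x => by
    refine le_of_tendsto (x := (U : Filter (Space p n))) (tendsto_const_nhds.sub hlim).abs ?_
    have hfar : ∀ᶠ y in (U : Filter (Space p n)), ‖x‖ ≤ ‖y‖ :=
      Ultrafilter.of_le _ (tendsto_norm_cobounded_atTop.eventually_ge_atTop ‖x‖)
    filter_upwards [hfar] with y hy
    simpa only [logSize, min_eq_left hy] using hdecay x y
  refine ⟨Q, C, hq.isExponent.one_lt_inf.trans_le hQ.1, hC, hbound, ?_⟩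
  refine tendsto_iff_dist_tendsto_zero.2 (squeeze_zero (fun _ => dist_nonneg) hbound ?_)
  exact tendsto_const_nhds.div_atTop tendsto_logSize_cobounded

/-! ### Changing the exponent at infinity -/

/-- An integrable weight that decays polynomially, but not faster, at infinity. -/
def weight (x : Space p n) : ℝ≥0∞ :=
  ∑' k : ℕ, (pBall (k : ℤ) (0 : Space p n)).indicator
    (fun _ => (p : ℝ≥0∞) ^ (-((n : ℝ) + 1) * k)) x

lemma measurable_weight : Measurable (weight : Space p n → ℝ≥0∞) :=
  Measurable.tsum fun _ => measurable_const.indicator (measurableSet_pBall _ _)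

lemma lintegral_weight_ne_top : ∫⁻ x, weight x ∂haar p n ≠ ∞ := by
  have hgeometric : ∫⁻ x, weight x ∂haar p n = ∑' k : ℕ, ((p : ℝ≥0∞)⁻¹) ^ k := by
    unfold weight
    rw [lintegral_tsum fun k => (measurable_const.indicator (measurableSet_pBall _ _)).aemeasurable]
    refine tsum_congr fun k => ?_
    rw [lintegral_indicator (measurableSet_pBall _ _), setLIntegral_const, haar_pBall, vol,
      ← ENNReal.rpow_add _ _ (prime_ne_zero p) (ENNReal.natCast_ne_top p), ← ENNReal.inv_pow,
      ← ENNReal.rpow_natCast, ← ENNReal.rpow_neg]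
    push_cast
    ring_nf
  rw [hgeometric, ENNReal.tsum_geometric]
  exact ENNReal.inv_ne_top.2 (tsub_pos_of_lt (ENNReal.inv_lt_one.2 (one_lt_prime p))).ne'

lemma rpow_logSize_le_weight (x : Space p n) :
    (p : ℝ≥0∞) ^ (-(2 * ((n : ℝ) + 1) * logSize x)) ≤ weight x := by
  have hlog := one_le_logSize x
  have hceil : (⌈logSize x⌉₊ : ℝ) ≤ 2 * logSize x := by
    linarith [Nat.ceil_lt_add_one (zero_le_one.trans hlog)]
  have hx : x ∈ pBall (⌈logSize x⌉₊ : ℤ) (0 : Space p n) := by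
    rw [pBall, mem_closedBall, dist_zero_right, zpow_natCast, ← Real.rpow_natCast]
    calc ‖x‖ ≤ p + ‖x‖ := le_add_of_nonneg_left p.cast_nonneg
      _ = (p : ℝ) ^ logSize x := (rpow_logSize x).symm
      _ ≤ _ := Real.rpow_le_rpow_of_exponent_le (one_lt_prime_real p).le (Nat.le_ceil _)
  refine le_trans ?_ (ENNReal.le_tsum ⌈logSize x⌉₊)
  rw [Set.indicator_of_mem hx]
  refine ENNReal.rpow_le_rpow_of_exponent_le (one_lt_prime p).le ?_
  nlinarith [show (0 : ℝ) ≤ n + 1 by positivity]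

/-- Either `g ≤ weight x`, or `g` is at least a power of `p ^ (-logSize x)` and `g ^ (s - t)` is
bounded. -/
lemma rpow_le_mul_rpow_add_weight {C s t : ℝ} {x : Space p n} (hC : 0 ≤ C) (hs : 1 ≤ s)
    (hst : |s - t| ≤ C / logSize x) {g : ℝ≥0∞} (hg : g ≤ 1) :
    g ^ s ≤ (p : ℝ≥0∞) ^ (2 * ((n : ℝ) + 1) * C) * g ^ t + weight x := by
  have hp := (one_lt_prime p).le
  rcases le_or_gt g (weight x) with hsmall | hlarge
  · refine le_add_left (le_trans ?_ hsmall)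
    simpa using ENNReal.rpow_le_rpow_of_exponent_ge hg hs
  refine le_add_right ?_
  have hexp : (t - s) * logSize x ≤ C := by
    rw [← le_div_iff₀ (one_pos.trans_le (one_le_logSize x))]
    exact (le_abs_self _).trans (abs_sub_comm s t ▸ hst)
  have hpow : g ^ (s - t) ≤ (p : ℝ≥0∞) ^ (2 * ((n : ℝ) + 1) * C) := by
    rcases le_total t s with hts | hts
    · calc g ^ (s - t) ≤ 1 := ENNReal.rpow_le_one hg (sub_nonneg.2 hts)
        _ = (p : ℝ≥0∞) ^ (0 : ℝ) := ENNReal.rpow_zero.symm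
        _ ≤ _ := ENNReal.rpow_le_rpow_of_exponent_le hp (by positivity)
    calc g ^ (s - t) = (g⁻¹) ^ (t - s) := by rw [ENNReal.inv_rpow, ← ENNReal.rpow_neg, neg_sub]
      _ ≤ (((p : ℝ≥0∞) ^ (-(2 * ((n : ℝ) + 1) * logSize x)))⁻¹) ^ (t - s) := by
          gcongr
          exact (rpow_logSize_le_weight x).trans hlarge.le
      _ = (p : ℝ≥0∞) ^ (2 * ((n : ℝ) + 1) * ((t - s) * logSize x)) := by
          rw [ENNReal.rpow_neg, inv_inv, ← ENNReal.rpow_mul]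
          ring_nf
      _ ≤ _ := ENNReal.rpow_le_rpow_of_exponent_le hp (by gcongr)
  calc g ^ s = g ^ (s - t) * g ^ t := by
        rw [← ENNReal.rpow_add _ _ (pos_of_gt hlarge).ne' (hg.trans_lt ENNReal.one_lt_top).ne,
          sub_add_cancel]
    _ ≤ _ := by gcongr

lemma lintegral_rpow_le_of_decay {C S : ℝ} (hC : 0 ≤ C) {s t : Space p n → ℝ}
    (hs : ∀ x, 1 ≤ s x) (hS : ∀ x, s x ≤ S) (ht : ∀ x, 0 ≤ t x)
    (hst : ∀ x, |s x - t x| ≤ C / logSize x) {K : ℝ≥0∞} (hK₁ : 1 ≤ K) (hK : K ≠ ∞)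
    {g : Space p n → ℝ≥0∞} (hg : ∀ x, g x ≤ K) :
    ∫⁻ x, g x ^ s x ∂haar p n ≤ K ^ S * ((p : ℝ≥0∞) ^ (2 * ((n : ℝ) + 1) * C) *
      ∫⁻ x, g x ^ t x ∂haar p n + ∫⁻ x, weight x ∂haar p n) := by
  have hS₀ : 0 ≤ S := zero_le_one.trans ((hs 0).trans (hS 0))
  have hD : (p : ℝ≥0∞) ^ (2 * ((n : ℝ) + 1) * C) ≠ ∞ := by finiteness [prime_ne_zero p]
  have hpointwise : ∀ x, g x ^ s x ≤
      K ^ S * ((p : ℝ≥0∞) ^ (2 * ((n : ℝ) + 1) * C) * g x ^ t x + weight x) := fun x => by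
    have hscaled : K⁻¹ * g x ≤ 1 := by
      rw [mul_comm, ← div_eq_mul_inv]
      exact ENNReal.div_le_of_le_mul (by simpa using hg x)
    calc g x ^ s x = K ^ s x * (K⁻¹ * g x) ^ s x := by
          rw [← ENNReal.mul_rpow_of_nonneg _ _ (zero_le_one.trans (hs x)),
            ENNReal.mul_inv_cancel_left (one_pos.trans_le hK₁).ne' hK]
      _ ≤ K ^ S * ((p : ℝ≥0∞) ^ (2 * ((n : ℝ) + 1) * C) * (K⁻¹ * g x) ^ t x + weight x) := by
          gcongr
          · exact hS x
          · exact rpow_le_mul_rpow_add_weight hC (hs x) (hst x) hscaled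
      _ ≤ _ := by
          gcongr
          · exact ht x
          · exact mul_le_of_le_one_left' (ENNReal.inv_le_one.2 hK₁)
  refine (lintegral_mono hpointwise).trans_eq ?_
  rw [lintegral_const_mul' _ _ (ENNReal.rpow_ne_top_of_nonneg hS₀ hK),
    lintegral_add_right _ measurable_weight, lintegral_const_mul' _ _ hD]

/-! ### Boundedness of the fractional maximal function for variable exponents -/

lemma IsExponent.le_of_one_div_eq {r q : Space p n → ℝ} (hr : IsExponent r) (hq : IsExponent q)
    {α : ℝ} (hα : 0 ≤ α) (h : ∀ x, 1 / q x = 1 / r x - α) (x : Space p n) : r x ≤ q x := by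
  rw [← one_div_le_one_div (one_pos.trans (hq.one_lt x)) (one_pos.trans (hr.one_lt x)), h x]
  exact sub_le_self _ hα

/-- The average `a` of a function over a ball of volume `V` satisfies `a ^ ρ ≤ V⁻¹` if the
integral of its power with exponent `ρ` is at most one. -/
lemma rpow_mul_rpow_le_of_rpow_le_inv {V a : ℝ≥0∞} (hV₀ : V ≠ 0) (hV : V ≠ ∞) {α ρ r q : ℝ}
    (hρ : 0 < ρ) (hρr : ρ ≤ r) (hrq : r ≤ q) (h : 1 / q = 1 / r - α) (ha : a ^ ρ ≤ V⁻¹) :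
    (V ^ α * a) ^ q ≤ V ^ (-(q / (r * ρ) * (r - ρ))) * a ^ ρ := by
  have hr : 0 < r := hρ.trans_le hρr
  have hq : 0 < q := hr.trans_le hrq
  have ha' : a ≤ V ^ (-(1 / ρ)) := by
    rwa [ENNReal.rpow_neg, ← ENNReal.inv_rpow, one_div, ENNReal.le_rpow_inv_iff hρ]
  calc (V ^ α * a) ^ q = V ^ (α * q) * (a ^ (q - ρ) * a ^ ρ) := by
        rw [ENNReal.mul_rpow_of_nonneg _ _ hq.le, ← ENNReal.rpow_mul,
          ← ENNReal.rpow_add_of_nonneg _ _ (by linarith) hρ.le, sub_add_cancel]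
    _ ≤ V ^ (α * q) * ((V ^ (-(1 / ρ))) ^ (q - ρ) * a ^ ρ) := by gcongr; linarith
    _ = V ^ (-(q / (r * ρ) * (r - ρ))) * a ^ ρ := by
        rw [← mul_assoc, ← ENNReal.rpow_mul, ← ENNReal.rpow_add _ _ hV₀ hV,
          show α = 1 / r - 1 / q by linarith]
        congr 2
        field_simp
        ring

lemma rpow_le_rpow_of_eq_zero_or_one_le {a : ℝ≥0∞} (ha : a = 0 ∨ 1 ≤ a) {s t : ℝ} (hs : 0 < s)
    (hst : s ≤ t) : a ^ s ≤ a ^ t := by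
  rcases ha with rfl | ha
  · simp [hs]
  · exact ENNReal.rpow_le_rpow_of_exponent_le ha hst

section SmallBalls

variable {F : Space p n → ℝ≥0∞} {r : Space p n → ℝ} {ρ : ℝ} {γ : ℤ} {x : Space p n}

lemma avg_rpow_le_vol_inv (hF : Measurable F) (hF₀ : ∀ y, F y = 0 ∨ 1 ≤ F y) (hρ : 1 ≤ ρ)
    (hρr : ∀ᵐ y ∂haar p n, y ∈ pBall γ x → ρ ≤ r y) (hFr : ∫⁻ y, F y ^ r y ∂haar p n ≤ 1) :
    avg F γ x ^ ρ ≤ (vol p n γ)⁻¹ := by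
  calc avg F γ x ^ ρ ≤ avg (fun y => F y ^ ρ) γ x := avg_rpow_le hF hρ γ x
    _ ≤ avg (fun y => F y ^ r y) γ x := avg_mono_on (hρr.mono fun y h hy =>
        rpow_le_rpow_of_eq_zero_or_one_le (hF₀ y) (one_pos.trans_le hρ) (h hy))
    _ ≤ (vol p n γ)⁻¹ * ∫⁻ y, F y ^ r y ∂haar p n := avg_le_vol_inv_mul _ γ x
    _ ≤ (vol p n γ)⁻¹ := mul_le_of_le_one_right' hFr

lemma avg_rpow_le_maxFn_rpow (hF : Measurable F) (hF₀ : ∀ y, F y = 0 ∨ 1 ≤ F y) {s : ℝ}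
    (hs : 0 < s) (hsρ : s ≤ ρ) (hρr : ∀ᵐ y ∂haar p n, y ∈ pBall γ x → ρ ≤ r y) :
    avg F γ x ^ ρ ≤ maxFn (fun y => F y ^ (r y / s)) x ^ s := by
  calc avg F γ x ^ ρ = (avg F γ x ^ (ρ / s)) ^ s := by
        rw [← ENNReal.rpow_mul, div_mul_cancel₀ _ hs.ne']
    _ ≤ avg (fun y => F y ^ (ρ / s)) γ x ^ s := by
        gcongr
        exact avg_rpow_le hF ((one_le_div hs).2 hsρ) γ x
    _ ≤ avg (fun y => F y ^ (r y / s)) γ x ^ s := by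
        gcongr
        refine avg_mono_on (hρr.mono fun y h hy => ?_)
        exact rpow_le_rpow_of_eq_zero_or_one_le (hF₀ y) (div_pos (hs.trans_le hsρ) hs)
          (div_le_div_of_nonneg_right (h hy) hs.le)
    _ ≤ maxFn (fun y => F y ^ (r y / s)) x ^ s := by
        gcongr
        exact avg_le_maxFn _ γ x

end SmallBalls

lemma IsLogHolder.exists_vol_rpow_mul_avg_rpow_le {r q : Space p n → ℝ} (hr : IsLogHolder r)
    (hq : IsExponent q) {α : ℝ} (hα : 0 ≤ α) (h : ∀ x, 1 / q x = 1 / r x - α) :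
    ∃ D : ℝ≥0∞, D ≠ ∞ ∧ ∀ F : Space p n → ℝ≥0∞, Measurable F → (∀ y, F y = 0 ∨ 1 ≤ F y) →
      ∫⁻ y, F y ^ r y ∂haar p n ≤ 1 → ∀ᵐ x ∂haar p n, ∀ γ : ℤ, γ ≤ 0 →
        (vol p n γ ^ α * avg F γ x) ^ q x ≤
          D * maxFn (fun y => F y ^ (r y / expInf r Set.univ)) x ^ expInf r Set.univ := by
  obtain ⟨C, hC, hloc⟩ := hr.local_bound
  obtain ⟨L, hL⟩ := hq.bounded
  have hp : (p : ℝ≥0∞) ^ ((n : ℝ) * (L * C)) ≠ ∞ := by finiteness [prime_ne_zero p]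
  refine ⟨_, hp, fun F hF hF₀ hFr => ?_⟩
  filter_upwards [hr.isExponent.ae_forall_mem_Icc] with x hx γ hγ
  set s := expInf r Set.univ
  set ρ := expInf r (pBall γ x)
  have hs : 1 < s := hr.isExponent.one_lt_inf
  have hsρ : s ≤ ρ := hr.isExponent.inf_le_expInf γ x
  have hρ : 1 < ρ := hs.trans_le hsρ
  have hρr : ρ ≤ r x := (hx γ).1
  have hr₁ : 1 < r x := hr.isExponent.one_lt x
  have hρr' : ∀ᵐ y ∂haar p n, y ∈ pBall γ x → ρ ≤ r y :=
    (hr.isExponent.ae_mem_Icc γ x).mono fun y h hy => (h hy).1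
  have hloc' : -(γ : ℝ) * (r x - ρ) ≤ C := by
    have hγ' : (0 : ℝ) ≤ -γ := by exact_mod_cast neg_nonneg.2 hγ
    linarith [hloc γ x, mul_le_mul_of_nonneg_left (hx γ).2 hγ']
  have hvol : vol p n γ ^ (-(q x / (r x * ρ) * (r x - ρ))) ≤ (p : ℝ≥0∞) ^ ((n : ℝ) * (L * C)) := by
    rw [vol_rpow, mul_assoc]
    refine ENNReal.rpow_le_rpow_of_exponent_le (one_lt_prime p).le ?_
    refine mul_le_mul_of_nonneg_left ?_ n.cast_nonneg
    have hq₀ : 0 < q x := one_pos.trans (hq.one_lt x)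
    calc (γ : ℝ) * -(q x / (r x * ρ) * (r x - ρ)) = q x / (r x * ρ) * (-γ * (r x - ρ)) := by ring
      _ ≤ q x / (r x * ρ) * C := by gcongr
      _ ≤ L * C := by
          gcongr
          exact (div_le_self hq₀.le (one_le_mul_of_one_le_of_one_le hr₁.le hρ.le)).trans
            ((le_abs_self _).trans (hL x))
  calc (vol p n γ ^ α * avg F γ x) ^ q x
      ≤ vol p n γ ^ (-(q x / (r x * ρ) * (r x - ρ))) * avg F γ x ^ ρ :=
        rpow_mul_rpow_le_of_rpow_le_inv (vol_ne_zero p n γ) (vol_ne_top p n γ) (one_pos.trans hρ)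
          hρr (hr.isExponent.le_of_one_div_eq hq hα h x) (h x)
          (avg_rpow_le_vol_inv hF hF₀ hρ.le hρr' hFr)
    _ ≤ _ := mul_le_mul' hvol (avg_rpow_le_maxFn_rpow hF hF₀ (one_pos.trans hs) hsρ hρr')

section Regularization

/-- The restriction of a function to the set where it is at least one, which is controlled by the
local log-Hölder condition. -/
def largePart (F : Space p n → ℝ≥0∞) : Space p n → ℝ≥0∞ := {y | 1 ≤ F y}.indicator F

/-- The restriction of a function to the set where it is less than one, which is controlled by the
decay condition. -/
def smallPart (F : Space p n → ℝ≥0∞) : Space p n → ℝ≥0∞ := {y | 1 ≤ F y}ᶜ.indicator F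

/-- The bounded function that results from replacing the large part of `F` by its averages over
unit balls. It has the same averages as `F` over all balls of radius at least one. -/
def regularization (F : Space p n → ℝ≥0∞) (x : Space p n) : ℝ≥0∞ :=
  avg (largePart F) 0 x + smallPart F x

variable {F : Space p n → ℝ≥0∞} {r : Space p n → ℝ}

lemma largePart_add_smallPart (F : Space p n → ℝ≥0∞) (x : Space p n) :
    largePart F x + smallPart F x = F x :=
  congrFun (Set.indicator_self_add_compl _ F) x

lemma largePart_le (F : Space p n → ℝ≥0∞) (x : Space p n) : largePart F x ≤ F x :=
  Set.indicator_le_self _ F x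

lemma smallPart_le (F : Space p n → ℝ≥0∞) (x : Space p n) : smallPart F x ≤ F x :=
  Set.indicator_le_self _ F x

lemma largePart_eq_zero_or_one_le (F : Space p n → ℝ≥0∞) (x : Space p n) :
    largePart F x = 0 ∨ 1 ≤ largePart F x := by
  by_cases hx : x ∈ {y | 1 ≤ F y}
  · exact .inr (by rwa [largePart, Set.indicator_of_mem hx])
  · exact .inl (Set.indicator_of_notMem hx F)

lemma smallPart_le_one (F : Space p n → ℝ≥0∞) (x : Space p n) : smallPart F x ≤ 1 := by
  refine Set.indicator_le' (fun y hy => ?_) (fun y _ => zero_le_one) x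
  exact (lt_of_not_ge fun h => hy h).le

lemma measurable_largePart (hF : Measurable F) : Measurable (largePart F) :=
  hF.indicator (measurableSet_le measurable_const hF)

lemma measurable_smallPart (hF : Measurable F) : Measurable (smallPart F) :=
  hF.indicator (measurableSet_le measurable_const hF).compl

lemma measurable_regularization (hF : Measurable F) : Measurable (regularization F) :=
  (measurable_avg _ 0).add (measurable_smallPart hF)

lemma avg_regularization (hF : Measurable F) {γ : ℤ} (hγ : 0 ≤ γ) (x : Space p n) :
    avg (regularization F) γ x = avg F γ x := by
  unfold regularization
  rw [avg_add (measurable_avg _ 0), avg_avg (measurable_largePart hF) hγ,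
    ← avg_add (measurable_largePart hF), funext (largePart_add_smallPart F)]

lemma avg_le_avg_largePart_add (hF : Measurable F) (γ : ℤ) (x : Space p n) :
    avg F γ x ≤ avg (largePart F) γ x + avg (regularization F) γ x := by
  rw [← avg_add (measurable_largePart hF)]
  refine avg_mono (fun y => ?_) γ x
  rw [← largePart_add_smallPart F y]
  gcongr
  exact le_add_self

lemma lintegral_largePart_le (hr : ∀ x, 1 ≤ r x) (hFr : ∫⁻ x, F x ^ r x ∂haar p n ≤ 1) :
    ∫⁻ x, largePart F x ∂haar p n ≤ 1 := by
  refine le_trans (lintegral_mono fun x => ?_) hFr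
  calc largePart F x = largePart F x ^ (1 : ℝ) := (ENNReal.rpow_one _).symm
    _ ≤ largePart F x ^ r x :=
        rpow_le_rpow_of_eq_zero_or_one_le (largePart_eq_zero_or_one_le F x) one_pos (hr x)
    _ ≤ F x ^ r x := ENNReal.rpow_le_rpow (largePart_le F x) (zero_le_one.trans (hr x))

lemma avg_largePart_zero_le_one (hr : ∀ x, 1 ≤ r x) (hFr : ∫⁻ x, F x ^ r x ∂haar p n ≤ 1)
    (x : Space p n) : avg (largePart F) 0 x ≤ 1 := by
  refine (avg_le_vol_inv_mul _ 0 x).trans ?_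
  rw [vol_zero, inv_one, one_mul]
  exact lintegral_largePart_le hr hFr

lemma regularization_le_two (hr : ∀ x, 1 ≤ r x) (hFr : ∫⁻ x, F x ^ r x ∂haar p n ≤ 1)
    (x : Space p n) : regularization F x ≤ 2 := by
  rw [← one_add_one_eq_two]
  exact add_le_add (avg_largePart_zero_le_one hr hFr x) (smallPart_le_one F x)

lemma exists_lintegral_regularization_rpow_le {R C : ℝ} (hR : 1 ≤ R) (hC : 0 ≤ C)
    (hr : ∀ x, 1 ≤ r x) (hrR : ∀ x, |r x - R| ≤ C / logSize x) :
    ∃ A : ℝ≥0∞, A ≠ ∞ ∧ ∀ F : Space p n → ℝ≥0∞, Measurable F →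
      ∫⁻ x, F x ^ r x ∂haar p n ≤ 1 → ∫⁻ x, regularization F x ^ R ∂haar p n ≤ A := by
  set B : ℝ≥0∞ := 1 ^ R * ((p : ℝ≥0∞) ^ (2 * ((n : ℝ) + 1) * C) * 1 +
    ∫⁻ x : Space p n, weight x ∂haar p n)
  have hB : B ≠ ∞ := by finiteness [prime_ne_zero p, lintegral_weight_ne_top (p := p) (n := n)]
  have hsmall : ∀ F : Space p n → ℝ≥0∞, ∫⁻ x, F x ^ r x ∂haar p n ≤ 1 →
      ∫⁻ x, smallPart F x ^ R ∂haar p n ≤ B := fun F hFr => by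
    refine (lintegral_rpow_le_of_decay hC (fun _ => hR) (fun _ => le_rfl)
      (fun x => zero_le_one.trans (hr x)) (fun x => abs_sub_comm R (r x) ▸ hrR x) le_rfl
      ENNReal.one_ne_top (smallPart_le_one F)).trans ?_
    refine mul_le_mul_right (add_le_add_left (mul_le_mul_right (le_trans ?_ hFr) _) _) _
    refine lintegral_mono fun x => ?_
    exact ENNReal.rpow_le_rpow (smallPart_le F x) (zero_le_one.trans (hr x))
  have hlarge : ∀ F : Space p n → ℝ≥0∞, Measurable F → ∫⁻ x, F x ^ r x ∂haar p n ≤ 1 →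
      ∫⁻ x, avg (largePart F) 0 x ^ R ∂haar p n ≤ 1 := fun F hF hFr => by
    refine (lintegral_mono fun x => ?_).trans
      ((lintegral_avg (measurable_largePart hF) 0).trans_le (lintegral_largePart_le hr hFr))
    simpa only [ENNReal.rpow_one] using
      ENNReal.rpow_le_rpow_of_exponent_ge (avg_largePart_zero_le_one hr hFr x) hR
  refine ⟨2 ^ (R - 1) * (1 + B), by finiteness, fun F hF hFr => ?_⟩
  calc ∫⁻ x, regularization F x ^ R ∂haar p n
      ≤ ∫⁻ x, 2 ^ (R - 1) * (avg (largePart F) 0 x ^ R + smallPart F x ^ R) ∂haar p n :=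
        lintegral_mono fun x => ENNReal.rpow_add_le_mul_rpow_add_rpow _ _ hR
    _ = 2 ^ (R - 1) * (∫⁻ x, avg (largePart F) 0 x ^ R ∂haar p n +
          ∫⁻ x, smallPart F x ^ R ∂haar p n) := by
        rw [lintegral_const_mul' _ _ (by finiteness),
          lintegral_add_left ((measurable_avg _ 0).pow_const R)]
    _ ≤ 2 ^ (R - 1) * (1 + B) := by gcongr; exacts [hlarge F hF hFr, hsmall F hFr]

end Regularization

lemma exists_lintegral_fracMax_rpow_le_of_bounded {q : Space p n → ℝ} {α R Q c L : ℝ} (hα : 0 ≤ α)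
    (hR : 1 < R) (hQ : 0 < Q) (hRQ : 1 / Q = 1 / R - α) (hq : ∀ x, 1 ≤ q x) (hqL : ∀ x, q x ≤ L)
    (hc : 0 ≤ c) (hqQ : ∀ x, |q x - Q| ≤ c / logSize x) {A K : ℝ≥0∞} (hA : A ≠ ∞) (hK : K ≠ ∞) :
    ∃ E : ℝ≥0∞, E ≠ ∞ ∧ ∀ H : Space p n → ℝ≥0∞, Measurable H → (∀ x, H x ≤ K) →
      ∫⁻ x, H x ^ R ∂haar p n ≤ A → ∫⁻ x, fracMax α H x ^ q x ∂haar p n ≤ E := by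
  obtain ⟨M, hM, hmax⟩ := exists_lintegral_maxFn_rpow_le p n hR
  have hαR : α ≤ 1 / R := by linarith [one_div_pos.2 hQ]
  have hL : 0 ≤ L := zero_le_one.trans ((hq 0).trans (hqL 0))
  set K' : ℝ≥0∞ := max 1 (max K (A ^ (1 / R)))
  have hK' : K' ≠ ∞ := by finiteness
  refine ⟨K' ^ L * ((p : ℝ≥0∞) ^ (2 * ((n : ℝ) + 1) * c) * (A ^ (α * Q) * (M * A)) +
    ∫⁻ x : Space p n, weight x ∂haar p n), ?_, fun H hH hHK hHA => ?_⟩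
  · finiteness [prime_ne_zero p, lintegral_weight_ne_top (p := p) (n := n)]
  have hbounded : ∀ x, fracMax α H x ≤ K' := fun x => by
    refine (fracMax_le_max hH hα hR.le hαR hHK x).trans (le_max_of_le_right ?_)
    gcongr
  refine (lintegral_rpow_le_of_decay hc hq hqL (fun _ => hQ.le) hqQ (le_max_left _ _) hK'
    hbounded).trans ?_
  gcongr
  calc ∫⁻ x, fracMax α H x ^ Q ∂haar p n
      ≤ ∫⁻ x, A ^ (α * Q) * maxFn H x ^ R ∂haar p n := by
        refine lintegral_mono fun x => (fracMax_rpow_le hH hα hR.le hQ hRQ x).trans ?_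
        gcongr
    _ = A ^ (α * Q) * ∫⁻ x, maxFn H x ^ R ∂haar p n :=
        lintegral_const_mul _ ((measurable_maxFn H).pow_const R)
    _ ≤ A ^ (α * Q) * (M * A) := by
        gcongr
        exact (hmax H hH).trans (by gcongr)

lemma IsLogHolder.exists_fracMax_rpow_le {r q : Space p n → ℝ} (hr : IsLogHolder r)
    (hq : IsExponent q) {α : ℝ} (hα : 0 ≤ α) (h : ∀ x, 1 / q x = 1 / r x - α) :
    ∃ D : ℝ≥0∞, D ≠ ∞ ∧ ∀ F : Space p n → ℝ≥0∞, Measurable F → ∫⁻ x, F x ^ r x ∂haar p n ≤ 1 →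
      ∀ᵐ x ∂haar p n, fracMax α F x ^ q x ≤
        D * maxFn (fun y => largePart F y ^ (r y / expInf r Set.univ)) x ^ expInf r Set.univ +
          D * fracMax α (regularization F) x ^ q x := by
  obtain ⟨D, hD, hsmall⟩ := hr.exists_vol_rpow_mul_avg_rpow_le hq hα h
  obtain ⟨L, hL⟩ := hq.bounded
  have h2L : (2 : ℝ≥0∞) ^ (L - 1) ≠ ∞ := by finiteness
  refine ⟨2 ^ (L - 1) * (D + 1), by finiteness, fun F hF hFr => ?_⟩
  have hlarge : ∫⁻ y, largePart F y ^ r y ∂haar p n ≤ 1 := (lintegral_mono fun y =>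
    ENNReal.rpow_le_rpow (largePart_le F y) (one_pos.trans (hr.isExponent.one_lt y)).le).trans hFr
  filter_upwards [hsmall _ (measurable_largePart hF) (largePart_eq_zero_or_one_le F) hlarge]
    with x hx
  set m := maxFn (fun y => largePart F y ^ (r y / expInf r Set.univ)) x ^ expInf r Set.univ
  have hqx : 1 < q x := hq.one_lt x
  have hqx₀ : 0 < q x := one_pos.trans hqx
  have hsplit : fracMax α F x ≤ (D * m) ^ (q x)⁻¹ + fracMax α (regularization F) x := by
    refine iSup_le fun γ => ?_
    rcases le_total γ 0 with hγ | hγ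
    · calc vol p n γ ^ α * avg F γ x
          ≤ vol p n γ ^ α * avg (largePart F) γ x + vol p n γ ^ α * avg (regularization F) γ x := by
            rw [← mul_add]; gcongr; exact avg_le_avg_largePart_add hF γ x
        _ ≤ _ := add_le_add ((ENNReal.le_rpow_inv_iff hqx₀).2 (hx γ hγ))
            (vol_rpow_mul_avg_le_fracMax α _ γ x)
    · rw [← avg_regularization hF hγ]
      exact le_add_left (vol_rpow_mul_avg_le_fracMax α _ γ x)
  calc fracMax α F x ^ q x ≤ ((D * m) ^ (q x)⁻¹ + fracMax α (regularization F) x) ^ q x := by gcongr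
    _ ≤ 2 ^ (q x - 1) * (((D * m) ^ (q x)⁻¹) ^ q x + fracMax α (regularization F) x ^ q x) :=
        ENNReal.rpow_add_le_mul_rpow_add_rpow _ _ hqx.le
    _ = 2 ^ (q x - 1) * (D * m + 1 * fracMax α (regularization F) x ^ q x) := by
        rw [ENNReal.rpow_inv_rpow hqx₀.ne', one_mul]
    _ ≤ 2 ^ (L - 1) * ((D + 1) * m + (D + 1) * fracMax α (regularization F) x ^ q x) := by
        gcongr
        · exact one_le_two
        · exact (le_abs_self _).trans (hL x)
        · exact le_self_add
        · exact le_add_self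
    _ = _ := by ring

open Filter Topology in
lemma one_div_limit_eq [NeZero n] {r q : Space p n → ℝ} {α R Q : ℝ}
    (h : ∀ x, 1 / q x = 1 / r x - α) (hR : R ≠ 0) (hQ : Q ≠ 0)
    (hr : Tendsto r (Bornology.cobounded _) (𝓝 R)) (hq : Tendsto q (Bornology.cobounded _) (𝓝 Q)) :
    1 / Q = 1 / R - α := by
  have := NormedSpace.cobounded_neBot ℚ_[p] (Space p n)
  simp only [one_div] at h ⊢
  exact tendsto_nhds_unique (hq.inv₀ hQ)
    (((hr.inv₀ hR).sub_const α).congr fun x => (h x).symm)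

theorem exists_lintegral_fracMax_rpow_le [NeZero n] {r q : Space p n → ℝ} (hr : IsLogHolder r)
    (hq : IsLogHolder q) {α : ℝ} (hα : 0 ≤ α) (h : ∀ x, 1 / q x = 1 / r x - α) :
    ∃ C : ℝ≥0∞, C ≠ ∞ ∧ ∀ F : Space p n → ℝ≥0∞, Measurable F →
      ∫⁻ x, F x ^ r x ∂haar p n ≤ 1 → ∫⁻ x, fracMax α F x ^ q x ∂haar p n ≤ C := by
  obtain ⟨R, c₁, hR, hc₁, hrR, hrlim⟩ := hr.exists_limit
  obtain ⟨Q, c₂, hQ, hc₂, hqQ, hqlim⟩ := hq.exists_limit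
  have hr₁ : ∀ x, 1 ≤ r x := fun x => (hr.isExponent.one_lt x).le
  have hq₁ : ∀ x, 1 ≤ q x := fun x => (hq.isExponent.one_lt x).le
  have hRQ : 1 / Q = 1 / R - α :=
    one_div_limit_eq h (one_pos.trans hR).ne' (one_pos.trans hQ).ne' hrlim hqlim
  obtain ⟨L, hL⟩ := hq.isExponent.bounded
  obtain ⟨A, hA, hreg⟩ := exists_lintegral_regularization_rpow_le hR.le hc₁.le hr₁ hrR
  obtain ⟨E, hE, hbdd⟩ := exists_lintegral_fracMax_rpow_le_of_bounded hα hR (one_pos.trans hQ) hRQ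
    hq₁ (fun x => (le_abs_self _).trans (hL x)) hc₂.le hqQ hA (K := 2) (by finiteness)
  obtain ⟨D, hD, hpt⟩ := hr.exists_fracMax_rpow_le hq.isExponent hα h
  set s := expInf r Set.univ
  have hs : 1 < s := hr.isExponent.one_lt_inf
  obtain ⟨M, hM, hmax⟩ := exists_lintegral_maxFn_rpow_le p n hs
  refine ⟨D * M + D * E, by finiteness, fun F hF hFr => ?_⟩
  have hG : Measurable fun y => largePart F y ^ (r y / s) :=
    (measurable_largePart hF).pow (hr.isExponent.measurable.div_const s)
  have hGs : ∫⁻ y, (largePart F y ^ (r y / s)) ^ s ∂haar p n ≤ 1 := by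
    simp only [← ENNReal.rpow_mul, div_mul_cancel₀ _ (one_pos.trans hs).ne']
    exact (lintegral_mono fun y =>
      ENNReal.rpow_le_rpow (largePart_le F y) (zero_le_one.trans (hr₁ y))).trans hFr
  calc ∫⁻ x, fracMax α F x ^ q x ∂haar p n
      ≤ ∫⁻ x, D * maxFn (fun y => largePart F y ^ (r y / s)) x ^ s +
          D * fracMax α (regularization F) x ^ q x ∂haar p n := lintegral_mono_ae (hpt F hF hFr)
    _ = D * ∫⁻ x, maxFn (fun y => largePart F y ^ (r y / s)) x ^ s ∂haar p n +
          D * ∫⁻ x, fracMax α (regularization F) x ^ q x ∂haar p n := by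
        rw [lintegral_add_left (((measurable_maxFn _).pow_const s).const_mul D),
          lintegral_const_mul' _ _ hD, lintegral_const_mul' _ _ hD]
    _ ≤ D * M + D * E := by
        gcongr
        · exact (hmax _ hG).trans (mul_le_of_le_one_right' hGs)
        · exact hbdd _ (measurable_regularization hF) (regularization_le_two hr₁ hFr)
            (hreg F hF hFr)

/-! ### The Luxemburg norm -/

section Luxemburg

variable {X : Type*} [MeasurableSpace X]

/-- The Luxemburg norm with exponent `q` of a nonnegative function on a measure space; it is
infinite if no `η` is admissible. -/
def luxemburgNorm (μ : Measure X) (q : X → ℝ) (F : X → ℝ≥0∞) : ℝ≥0∞ :=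
  ⨅ (η : ℝ≥0) (_ : 0 < η ∧ ∫⁻ x, (F x / η) ^ q x ∂μ ≤ 1), (η : ℝ≥0∞)

variable {μ : Measure X} {q r : X → ℝ} {F G : X → ℝ≥0∞}

lemma luxemburgNorm_le {η : ℝ≥0} (hη : 0 < η) (h : ∫⁻ x, (F x / η) ^ q x ∂μ ≤ 1) :
    luxemburgNorm μ q F ≤ η :=
  iInf₂_le η ⟨hη, h⟩

lemma exists_lintegral_rpow_le_one (h : luxemburgNorm μ q F ≠ ∞) :
    ∃ η : ℝ≥0, 0 < η ∧ ∫⁻ x, (F x / η) ^ q x ∂μ ≤ 1 := by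
  obtain ⟨η, hη⟩ := iInf_lt_iff.1 h.lt_top
  obtain ⟨hη', -⟩ := iInf_lt_iff.1 hη
  exact ⟨η, hη'⟩

lemma luxemburgNorm_mono (hq : ∀ x, 0 ≤ q x) (h : ∀ᵐ x ∂μ, F x ≤ G x) :
    luxemburgNorm μ q F ≤ luxemburgNorm μ q G := by
  refine le_iInf₂ fun η hη => luxemburgNorm_le hη.1 (le_trans (lintegral_mono_ae ?_) hη.2)
  filter_upwards [h] with x hx
  exact ENNReal.rpow_le_rpow (ENNReal.div_le_div_right hx _) (hq x)

lemma luxemburgNorm_le_mul {c : ℝ≥0} (hc : 0 < c)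
    (h : ∀ η : ℝ≥0, 0 < η → ∫⁻ x, (G x / η) ^ r x ∂μ ≤ 1 → luxemburgNorm μ q F ≤ c * η) :
    luxemburgNorm μ q F ≤ c * luxemburgNorm μ r G := by
  have hc₀ : (c : ℝ≥0∞) ≠ 0 := ENNReal.coe_ne_zero.2 hc.ne'
  rw [mul_comm, ← ENNReal.div_le_iff hc₀ ENNReal.coe_ne_top]
  refine le_iInf₂ fun η hη => ENNReal.div_le_of_le_mul ?_
  rw [mul_comm]
  exact h η hη.1 hη.2

lemma luxemburgNorm_const_mul_le (F : X → ℝ≥0∞) {c : ℝ≥0} (hc : 0 < c) :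
    luxemburgNorm μ q (fun x => c * F x) ≤ c * luxemburgNorm μ q F := by
  have hc₀ : (c : ℝ≥0∞) ≠ 0 := ENNReal.coe_ne_zero.2 hc.ne'
  refine luxemburgNorm_le_mul hc fun η hη h => ?_
  rw [← ENNReal.coe_mul]
  refine luxemburgNorm_le (mul_pos hc hη) ?_
  simpa only [ENNReal.coe_mul, ENNReal.mul_div_mul_left _ _ hc₀ ENNReal.coe_ne_top] using h

lemma mul_luxemburgNorm_le (F : X → ℝ≥0∞) {c : ℝ≥0} (hc : 0 < c) :
    c * luxemburgNorm μ q F ≤ luxemburgNorm μ q fun x => c * F x := by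
  have hc₀ : (c : ℝ≥0∞) ≠ 0 := ENNReal.coe_ne_zero.2 hc.ne'
  have h := luxemburgNorm_const_mul_le (μ := μ) (q := q) (fun x => c * F x) (inv_pos.2 hc)
  simp only [← mul_assoc, ENNReal.coe_inv hc.ne', ENNReal.inv_mul_cancel hc₀ ENNReal.coe_ne_top,
    one_mul] at h
  rwa [mul_comm, ← ENNReal.le_div_iff_mul_le (.inl hc₀) (.inl ENNReal.coe_ne_top),
    ENNReal.div_eq_inv_mul]

lemma luxemburgNorm_le_mul_of_lintegral_le (hq : ∀ x, 1 ≤ q x) {C η : ℝ≥0} (hC : 1 ≤ C)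
    (hη : 0 < η) (h : ∫⁻ x, (F x / η) ^ q x ∂μ ≤ C) : luxemburgNorm μ q F ≤ C * η := by
  have hC₀ : (C : ℝ≥0∞) ≠ 0 := ENNReal.coe_ne_zero.2 (one_pos.trans_le hC).ne'
  have hC₁ : (C : ℝ≥0∞)⁻¹ ≤ 1 := ENNReal.inv_le_one.2 (by exact_mod_cast hC)
  rw [← ENNReal.coe_mul]
  refine luxemburgNorm_le (mul_pos (one_pos.trans_le hC) hη) ?_
  calc ∫⁻ x, (F x / (C * η : ℝ≥0)) ^ q x ∂μ ≤ ∫⁻ x, (C : ℝ≥0∞)⁻¹ * (F x / η) ^ q x ∂μ := by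
        refine lintegral_mono fun x => ?_
        have hq₀ : 0 ≤ q x := zero_le_one.trans (hq x)
        calc (F x / (C * η : ℝ≥0)) ^ q x = ((C : ℝ≥0∞)⁻¹ * (F x / η)) ^ q x := by
              rw [ENNReal.coe_mul, div_eq_mul_inv, div_eq_mul_inv,
                ENNReal.mul_inv (.inl hC₀) (.inl ENNReal.coe_ne_top), mul_left_comm]
          _ = (C : ℝ≥0∞)⁻¹ ^ q x * (F x / η) ^ q x := ENNReal.mul_rpow_of_nonneg _ _ hq₀
          _ ≤ (C : ℝ≥0∞)⁻¹ * (F x / η) ^ q x := by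
              gcongr
              simpa only [ENNReal.rpow_one] using ENNReal.rpow_le_rpow_of_exponent_ge hC₁ (hq x)
    _ = (C : ℝ≥0∞)⁻¹ * ∫⁻ x, (F x / η) ^ q x ∂μ :=
        lintegral_const_mul' _ _ (ENNReal.inv_ne_top.2 hC₀)
    _ ≤ (C : ℝ≥0∞)⁻¹ * C := by gcongr
    _ = 1 := ENNReal.inv_mul_cancel hC₀ ENNReal.coe_ne_top

lemma luxemburgNorm_ne_top (hq : ∀ x, 1 ≤ q x) {η : ℝ≥0} (hη : 0 < η)
    (h : ∫⁻ x, (F x / η) ^ q x ∂μ ≠ ∞) : luxemburgNorm μ q F ≠ ∞ := by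
  lift ∫⁻ x, (F x / η) ^ q x ∂μ to ℝ≥0 using h with I hI
  refine ne_top_of_le_ne_top (ENNReal.mul_ne_top ENNReal.coe_ne_top ENNReal.coe_ne_top)
    (luxemburgNorm_le_mul_of_lintegral_le hq (le_max_left 1 I) hη ?_)
  rw [← hI]
  exact_mod_cast le_max_right 1 I

lemma ae_lt_top_of_luxemburgNorm_ne_top (hqm : Measurable q) (hq : ∀ x, 0 < q x)
    (hF : AEMeasurable F μ) (h : luxemburgNorm μ q F ≠ ∞) : ∀ᵐ x ∂μ, F x < ∞ := by
  obtain ⟨η, -, hη⟩ := exists_lintegral_rpow_le_one h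
  have hmeas : AEMeasurable (fun x => (F x / η) ^ q x) μ :=
    (hF.div_const _).pow hqm.aemeasurable
  filter_upwards [ae_lt_top' hmeas (hη.trans_lt ENNReal.one_lt_top).ne] with x hx
  refine lt_top_iff_ne_top.2 fun htop => hx.ne ?_
  rw [htop, ENNReal.top_div_of_ne_top ENNReal.coe_ne_top, ENNReal.top_rpow_of_pos (hq x)]

section Indicator

variable {E : Set X}

lemma lintegral_indicator_div_rpow (hq : ∀ x, 0 < q x) (hE : MeasurableSet E) (c : ℝ≥0∞) :
    ∫⁻ x, (E.indicator 1 x / c) ^ q x ∂μ = ∫⁻ x in E, c⁻¹ ^ q x ∂μ := by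
  rw [← lintegral_indicator hE]
  refine lintegral_congr fun x => ?_
  by_cases hx : x ∈ E <;> simp [hx, hq x]

lemma luxemburgNorm_indicator_ne_top (hq : ∀ x, 1 ≤ q x) (hE : MeasurableSet E) (hμE : μ E ≠ ∞) :
    luxemburgNorm μ q (E.indicator 1) ≠ ∞ := by
  refine luxemburgNorm_ne_top hq one_pos ?_
  rw [lintegral_indicator_div_rpow (fun x => one_pos.trans_le (hq x)) hE]
  simpa using hμE

lemma min_one_measure_le_luxemburgNorm_indicator (hq : ∀ x, 1 ≤ q x) (hE : MeasurableSet E) :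
    min 1 (μ E) ≤ luxemburgNorm μ q (E.indicator 1) := by
  refine le_iInf₂ fun η ⟨hη, hint⟩ => ?_
  rcases le_total 1 (η : ℝ≥0∞) with h | h
  · exact min_le_of_left_le h
  refine min_le_of_right_le ?_
  have hη₀ : (η : ℝ≥0∞) ≠ 0 := ENNReal.coe_ne_zero.2 hη.ne'
  rw [lintegral_indicator_div_rpow (fun x => one_pos.trans_le (hq x)) hE] at hint
  rw [← one_mul (η : ℝ≥0∞), ← ENNReal.div_le_iff hη₀ ENNReal.coe_ne_top]
  calc μ E / η = ∫⁻ _ in E, (η : ℝ≥0∞)⁻¹ ∂μ := by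
        rw [setLIntegral_const, mul_comm, div_eq_mul_inv]
    _ ≤ ∫⁻ x in E, (η : ℝ≥0∞)⁻¹ ^ q x ∂μ := by
        refine lintegral_mono fun x => ?_
        simpa only [ENNReal.rpow_one] using
          ENNReal.rpow_le_rpow_of_exponent_le (ENNReal.one_le_inv.2 h) (hq x)
    _ ≤ 1 := hint

lemma luxemburgNorm_indicator_ne_zero (hq : ∀ x, 1 ≤ q x) (hE : MeasurableSet E)
    (hμE : μ E ≠ 0) : luxemburgNorm μ q (E.indicator 1) ≠ 0 :=
  ((lt_min one_pos (pos_iff_ne_zero.2 hμE)).trans_le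
    (min_one_measure_le_luxemburgNorm_indicator hq hE)).ne'

lemma rpow_mul_rpow_le_add {a c : ℝ≥0∞} {s t : ℝ} (hs : 0 ≤ s) (ht : 0 ≤ t) (hst : s + t = 1) :
    c ^ s * a ^ t ≤ c + a := by
  calc c ^ s * a ^ t ≤ max c a ^ s * max c a ^ t := by
        gcongr
        exacts [le_max_left _ _, le_max_right _ _]
    _ = max c a := by rw [← ENNReal.rpow_add_of_nonneg _ _ hs ht, hst, ENNReal.rpow_one]
    _ ≤ c + a := max_le le_self_add le_add_self

lemma inv_rpow_mul_rpow_le_inv_add {V η : ℝ≥0∞} (hη₀ : η ≠ 0) (hη : η ≠ ∞) {α r q : ℝ}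
    (hα : 0 ≤ α) (hr : 0 < r) (hq : 0 < q) (h : 1 / q = 1 / r - α) :
    (V ^ α * η)⁻¹ ^ r ≤ V⁻¹ + η⁻¹ ^ q := by
  have hsum : α * r + r / q = 1 := by
    rw [div_eq_mul_one_div, h]
    field_simp
    ring
  calc (V ^ α * η)⁻¹ ^ r = V⁻¹ ^ (α * r) * (η⁻¹ ^ q) ^ (r / q) := by
        rw [ENNReal.mul_inv (.inr hη) (.inr hη₀), ENNReal.mul_rpow_of_nonneg _ _ hr.le,
          ← ENNReal.inv_rpow, ← ENNReal.rpow_mul, ← ENNReal.rpow_mul, mul_div_cancel₀ _ hq.ne']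
    _ ≤ V⁻¹ + η⁻¹ ^ q :=
        rpow_mul_rpow_le_add (mul_nonneg hα hr.le) (div_nonneg hr.le hq.le) hsum

/-- Hölder's inequality for `χ_E`, the exponent of the second factor being the constant `1 / α`. -/
lemma luxemburgNorm_indicator_le {α : ℝ} (hα : 0 ≤ α) (hr : ∀ x, 1 ≤ r x) (hq : ∀ x, 1 ≤ q x)
    (h : ∀ x, 1 / q x = 1 / r x - α) (hE : MeasurableSet E) (hE₀ : μ E ≠ 0) (hE' : μ E ≠ ∞) :
    luxemburgNorm μ r (E.indicator 1) ≤ 2 * μ E ^ α * luxemburgNorm μ q (E.indicator 1) := by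
  have hr₀ : ∀ x, 0 < r x := fun x => one_pos.trans_le (hr x)
  have hq₀ : ∀ x, 0 < q x := fun x => one_pos.trans_le (hq x)
  have hV₀ : μ E ^ α ≠ 0 := (ENNReal.rpow_pos (pos_iff_ne_zero.2 hE₀) hE').ne'
  lift μ E ^ α to ℝ≥0 using ENNReal.rpow_ne_top_of_ne_zero hE₀ hE' with V hV
  have hVpos : 0 < V := pos_iff_ne_zero.2 (ENNReal.coe_ne_zero.1 hV₀)
  suffices luxemburgNorm μ r (E.indicator 1) ≤ (2 * V : ℝ≥0) * luxemburgNorm μ q (E.indicator 1) by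
    simpa only [ENNReal.coe_mul, ENNReal.coe_ofNat] using this
  refine luxemburgNorm_le_mul (by positivity) fun η hη hint => ?_
  rw [← ENNReal.coe_mul, mul_assoc, ENNReal.coe_mul]
  refine luxemburgNorm_le_mul_of_lintegral_le hr one_le_two (mul_pos hVpos hη) ?_
  rw [lintegral_indicator_div_rpow hq₀ hE] at hint
  rw [lintegral_indicator_div_rpow hr₀ hE]
  calc ∫⁻ x in E, ((V * η : ℝ≥0) : ℝ≥0∞)⁻¹ ^ r x ∂μ
      ≤ ∫⁻ x in E, ((μ E)⁻¹ + (η : ℝ≥0∞)⁻¹ ^ q x) ∂μ := by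
        refine lintegral_mono fun x => ?_
        rw [ENNReal.coe_mul, hV]
        exact inv_rpow_mul_rpow_le_inv_add (ENNReal.coe_ne_zero.2 hη.ne') ENNReal.coe_ne_top hα
          (hr₀ x) (hq₀ x) (h x)
    _ = 1 + ∫⁻ x in E, (η : ℝ≥0∞)⁻¹ ^ q x ∂μ := by
        rw [lintegral_add_left measurable_const, setLIntegral_const,
          ENNReal.inv_mul_cancel hE₀ hE']
    _ ≤ 1 + 1 := by gcongr
    _ = (2 : ℝ≥0) := by norm_num

end Indicator

end Luxemburg

theorem exists_luxemburgNorm_fracMax_le [NeZero n] {r q : Space p n → ℝ} (hr : IsLogHolder r)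
    (hq : IsLogHolder q) {α : ℝ} (hα : 0 ≤ α) (h : ∀ x, 1 / q x = 1 / r x - α) :
    ∃ C : ℝ≥0, ∀ F : Space p n → ℝ≥0∞, AEMeasurable F (haar p n) →
      luxemburgNorm (haar p n) q (fracMax α F) ≤ C * luxemburgNorm (haar p n) r F := by
  obtain ⟨C, hC, hmod⟩ := exists_lintegral_fracMax_rpow_le hr hq hα h
  lift C to ℝ≥0 using hC
  have hC₁ : 1 ≤ max 1 C := le_max_left 1 C
  refine ⟨max 1 C, fun F hF => luxemburgNorm_le_mul (one_pos.trans_le hC₁) fun η hη hadm => ?_⟩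
  refine luxemburgNorm_le_mul_of_lintegral_le (fun x => (hq.isExponent.one_lt x).le) hC₁ hη ?_
  have hη' : (η : ℝ≥0∞)⁻¹ ≠ ∞ := ENNReal.inv_ne_top.2 (ENNReal.coe_ne_zero.2 hη.ne')
  rw [fracMax_congr_ae hF.ae_eq_mk]
  have hmk : ∫⁻ x, ((η : ℝ≥0∞)⁻¹ * hF.mk F x) ^ r x ∂haar p n ≤ 1 := by
    refine (lintegral_congr_ae ?_).trans_le hadm
    filter_upwards [hF.ae_eq_mk] with x hx
    rw [← hx, ENNReal.div_eq_inv_mul]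
  calc ∫⁻ x, (fracMax α (hF.mk F) x / η) ^ q x ∂haar p n
      = ∫⁻ x, fracMax α (fun y => (η : ℝ≥0∞)⁻¹ * hF.mk F y) x ^ q x ∂haar p n := by
        simp only [fracMax_const_mul hη', ENNReal.div_eq_inv_mul]
    _ ≤ C := hmod _ (hF.measurable_mk.const_mul _) hmk
    _ ≤ (max 1 C : ℝ≥0) := by exact_mod_cast le_max_right 1 C

section VariableLebesgue

variable {q : Space p n → ℝ} {f : Space p n → EReal}

lemma measurable_ereal_abs : Measurable EReal.abs :=
  EReal.measurable_of_measurable_real (ENNReal.measurable_ofReal.comp measurable_id.abs)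

lemma enorm_eq_abs_coe (a : ℝ) : ‖a‖ₑ = (a : EReal).abs := by
  rw [EReal.abs_def, Real.enorm_eq_ofReal_abs]

lemma luxNorm_eq_luxemburgNorm (q : Space p n → ℝ) (f : Space p n → EReal) :
    luxNorm q f = luxemburgNorm (haar p n) q fun x => (f x).abs := rfl

lemma luxNorm_coe (q f : Space p n → ℝ) :
    luxNorm q (fun x => (f x : EReal)) = luxemburgNorm (haar p n) q fun x => ‖f x‖ₑ := by
  simp only [luxNorm_eq_luxemburgNorm, enorm_eq_abs_coe]

lemma MemVarLp.luxNorm_ne_top (hq : ∀ x, 1 ≤ q x) (hf : MemVarLp q f) : luxNorm q f ≠ ∞ := by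
  obtain ⟨-, η, hη, hmod⟩ := hf
  exact luxemburgNorm_ne_top hq hη hmod.ne

lemma memVarLp_of_luxNorm_ne_top (hf : AEMeasurable f (haar p n)) (h : luxNorm q f ≠ ∞) :
    MemVarLp q f := by
  obtain ⟨η, hη, hmod⟩ := exists_lintegral_rpow_le_one (luxNorm_eq_luxemburgNorm q f ▸ h)
  exact ⟨hf, η, hη, hmod.trans_lt ENNReal.one_lt_top⟩

lemma MemVarLp.aemeasurable_of_coe {f : Space p n → ℝ} (h : MemVarLp q fun x => (f x : EReal)) :
    AEMeasurable f (haar p n) :=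
  h.1.ereal_toReal

end VariableLebesgue

lemma IsLogHolder.ae_fracMax_lt_top [NeZero n] {r q : Space p n → ℝ} (hr : IsLogHolder r)
    (hq : IsLogHolder q) {α : ℝ} (hα : 0 ≤ α) (h : ∀ x, 1 / q x = 1 / r x - α)
    {F : Space p n → ℝ≥0∞} (hF : AEMeasurable F (haar p n))
    (hfin : luxemburgNorm (haar p n) r F ≠ ∞) : ∀ᵐ x ∂haar p n, fracMax α F x < ∞ := by
  obtain ⟨C, hC⟩ := exists_luxemburgNorm_fracMax_le hr hq hα h
  exact ae_lt_top_of_luxemburgNorm_ne_top hq.isExponent.measurable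
    (fun x => one_pos.trans (hq.isExponent.one_lt x)) (measurable_fracMax α F).aemeasurable
    (ne_top_of_le_ne_top (ENNReal.mul_ne_top ENNReal.coe_ne_top hfin) (hC F hF))

/-! ### Commutators with nonnegative Lipschitz functions -/

lemma avgAbs_eq_avg (f : Space p n → ℝ) (γ : ℤ) (x : Space p n) :
    avgAbs f γ x = avg (fun y => ‖f y‖ₑ) γ x := by
  rw [avgAbs, avg_eq, haar_pBall]

lemma maximal_eq_maxFn (f : Space p n → ℝ) : maximal f = maxFn fun y => ‖f y‖ₑ := by
  ext x
  simp only [maximal, maxFn, avgAbs_eq_avg]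

lemma maximal_congr_ae {f g : Space p n → ℝ} (h : f =ᵐ[haar p n] g) : maximal f = maximal g := by
  simp only [maximal_eq_maxFn, ← fracMax_zero]
  exact fracMax_congr_ae (h.mono fun y hy => by simp only [hy]) 0

lemma commutator_congr_ae {b b' f f' : Space p n → ℝ} (hb : b =ᵐ[haar p n] b')
    (hf : f =ᵐ[haar p n] f') : commutator b f =ᵐ[haar p n] commutator b' f' := by
  have hbf : maximal (fun y => b y * f y) = maximal fun y => b' y * f' y :=
    maximal_congr_ae (hb.mul hf)
  filter_upwards [hb] with x hx
  rw [commutator, commutator, hx, maximal_congr_ae hf, hbf]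

lemma measurable_maximal (f : Space p n → ℝ) : Measurable (maximal f) :=
  maximal_eq_maxFn f ▸ measurable_maxFn _

lemma aemeasurable_commutator {b : Space p n → ℝ} (hb : AEMeasurable b (haar p n))
    (f : Space p n → ℝ) : AEMeasurable (commutator b f) (haar p n) :=
  (hb.coe_real_ereal.mul (measurable_maximal f).coe_ereal_ennreal.aemeasurable).add
    (continuous_neg.measurable.comp (measurable_maximal _).coe_ereal_ennreal).aemeasurable

lemma abs_coe_sub_coe_le {A B E : ℝ≥0∞} (hA : A ≠ ∞) (hB : B ≠ ∞) (hAB : A ≤ B + E)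
    (hBA : B ≤ A + E) : ((A : EReal) - (B : EReal)).abs ≤ E := by
  rcases eq_or_ne E ∞ with rfl | hE
  · exact le_top
  lift A to ℝ≥0 using hA
  lift B to ℝ≥0 using hB
  lift E to ℝ≥0 using hE
  change ENNReal.ofReal |(A : ℝ) - B| ≤ E
  refine ENNReal.ofReal_le_of_le_toReal (abs_sub_le_iff.2 ⟨?_, ?_⟩)
  · exact sub_le_iff_le_add'.2 (by exact_mod_cast hAB)
  · exact sub_le_iff_le_add'.2 (by exact_mod_cast hBA)

section Multiplier

variable {w F : Space p n → ℝ≥0∞} {x : Space p n} {α : ℝ} {L : ℝ≥0∞}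

lemma mul_vol_rpow_mul_avg_le (F : Space p n → ℝ≥0∞) (L : ℝ≥0∞) (α : ℝ) (γ : ℤ) (x : Space p n) :
    L * vol p n γ ^ α * avg F γ x ≤ L * fracMax α F x := by
  rw [mul_assoc]
  exact mul_le_mul_right (vol_rpow_mul_avg_le_fracMax α F γ x) L

lemma maxFn_mul_le (hF : Measurable F) (hL : L ≠ ∞) (hwx : w x ≠ ∞)
    (hw : ∀ γ, ∀ y ∈ pBall γ x, w y ≤ w x + L * vol p n γ ^ α) :
    maxFn (fun y => w y * F y) x ≤ w x * maxFn F x + L * fracMax α F x := by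
  refine iSup_le fun γ => ?_
  calc avg (fun y => w y * F y) γ x
      ≤ avg (fun y => w x * F y + L * vol p n γ ^ α * F y) γ x := by
        refine avg_mono_on (.of_forall fun y hy => ?_)
        rw [← add_mul]
        exact mul_le_mul_left (hw γ y hy) _
    _ = w x * avg F γ x + L * vol p n γ ^ α * avg F γ x := by
        rw [avg_add (hF.const_mul _), avg_const_mul hwx,
          avg_const_mul (by finiteness [vol_ne_zero p n γ, vol_ne_top p n γ])]
    _ ≤ w x * maxFn F x + L * fracMax α F x :=
        add_le_add (mul_le_mul_right (avg_le_maxFn F γ x) _) (mul_vol_rpow_mul_avg_le F L α γ x)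

lemma mul_maxFn_le (hF : Measurable F) (hL : L ≠ ∞) (hwx : w x ≠ ∞)
    (hw : ∀ γ, ∀ y ∈ pBall γ x, w x ≤ w y + L * vol p n γ ^ α) :
    w x * maxFn F x ≤ maxFn (fun y => w y * F y) x + L * fracMax α F x := by
  rw [maxFn, ENNReal.mul_iSup]
  refine iSup_le fun γ => ?_
  calc w x * avg F γ x = avg (fun y => w x * F y) γ x := (avg_const_mul hwx F γ x).symm
    _ ≤ avg (fun y => L * vol p n γ ^ α * F y + w y * F y) γ x := by
        refine avg_mono_on (.of_forall fun y hy => ?_)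
        rw [← add_mul, add_comm]
        exact mul_le_mul_left (hw γ y hy) _
    _ = L * vol p n γ ^ α * avg F γ x + avg (fun y => w y * F y) γ x := by
        rw [avg_add (hF.const_mul _),
          avg_const_mul (by finiteness [vol_ne_zero p n γ, vol_ne_top p n γ])]
    _ ≤ L * fracMax α F x + maxFn (fun y => w y * F y) x :=
        add_le_add (mul_vol_rpow_mul_avg_le F L α γ x) (avg_le_maxFn _ γ x)
    _ = _ := add_comm _ _

end Multiplier

lemma MemLip.exists_abs_sub_le {β : ℝ} (hβ : β ≠ 0) {b : Space p n → ℝ} (hb : MemLip β b) :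
    ∃ L : ℝ≥0, 0 < L ∧ ∀ x y, |b x - b y| ≤ L * ‖x - y‖ ^ β := by
  refine ⟨(lipNorm β b).toNNReal + 1, by positivity, fun x y => ?_⟩
  rcases eq_or_ne x y with rfl | hxy
  · simp [hβ]
  have hpos : 0 < ‖x - y‖ ^ β := Real.rpow_pos_of_pos (norm_pos_iff.2 (sub_ne_zero.2 hxy)) β
  have hle : ENNReal.ofReal (|b x - b y| / ‖x - y‖ ^ β) ≤ lipNorm β b :=
    le_iSup_of_le x (le_iSup_of_le y (le_iSup_of_le hxy le_rfl))
  rw [← div_le_iff₀ hpos]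
  refine ((ENNReal.ofReal_le_iff_le_toReal hb.2.ne).1 hle).trans ?_
  exact_mod_cast le_add_of_nonneg_right (a := (lipNorm β b).toNNReal) zero_le_one

lemma ofReal_radius_rpow [NeZero n] (γ : ℤ) (β : ℝ) :
    ENNReal.ofReal (((p : ℝ) ^ γ) ^ β) = vol p n γ ^ (β / n) := by
  have hp : (0 : ℝ) < p := one_pos.trans (one_lt_prime_real p)
  have hn : (n : ℝ) ≠ 0 := NeZero.ne _
  rw [vol_rpow, ← Real.rpow_intCast, ← Real.rpow_mul hp.le, ← ENNReal.ofReal_rpow_of_pos hp,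
    ENNReal.ofReal_natCast]
  congr 1
  field_simp

lemma ofReal_le_ofReal_add_mul_vol_rpow [NeZero n] {β : ℝ} (hβ : 0 ≤ β) {b : Space p n → ℝ}
    {L : ℝ≥0} (hb : ∀ x y, |b x - b y| ≤ L * ‖x - y‖ ^ β) {γ : ℤ} {x y : Space p n}
    (h : x ∈ pBall γ y) :
    ENNReal.ofReal (b x) ≤ ENNReal.ofReal (b y) + L * vol p n γ ^ (β / n) := by
  have hxy : ‖x - y‖ ≤ (p : ℝ) ^ γ := by simpa only [pBall, mem_closedBall, dist_eq_norm] using h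
  have hle : b x ≤ b y + L * ((p : ℝ) ^ γ) ^ β := by
    rw [← sub_le_iff_le_add']
    exact ((le_abs_self _).trans (hb x y)).trans (by gcongr)
  calc ENNReal.ofReal (b x) ≤ ENNReal.ofReal (b y + L * ((p : ℝ) ^ γ) ^ β) :=
        ENNReal.ofReal_le_ofReal hle
    _ ≤ ENNReal.ofReal (b y) + ENNReal.ofReal (L * ((p : ℝ) ^ γ) ^ β) := ENNReal.ofReal_add_le
    _ = _ := by
        rw [ENNReal.ofReal_mul L.coe_nonneg, ofReal_radius_rpow (n := n), ENNReal.ofReal_coe_nnreal]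

lemma abs_commutator_le [NeZero n] {β : ℝ} (hβ : 0 ≤ β) {b f : Space p n → ℝ} {L : ℝ≥0}
    (hb₀ : ∀ x, 0 ≤ b x) (hb : ∀ x y, |b x - b y| ≤ L * ‖x - y‖ ^ β) (hf : Measurable f)
    {x : Space p n} (hM : maximal f x ≠ ∞) (hMβ : fracMax (β / n) (fun y => ‖f y‖ₑ) x ≠ ∞) :
    (commutator b f x).abs ≤ L * fracMax (β / n) (fun y => ‖f y‖ₑ) x := by
  set F : Space p n → ℝ≥0∞ := fun y => ‖f y‖ₑ
  set w : Space p n → ℝ≥0∞ := fun y => ENNReal.ofReal (b y)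
  have hF : Measurable F := hf.enorm
  have hmax : maximal (fun y => b y * f y) = maxFn fun y => w y * F y := by
    simp only [maximal_eq_maxFn, enorm_mul, Real.enorm_eq_ofReal (hb₀ _), w, F]
  have hcomm : commutator b f x =
      ((w x * maxFn F x : ℝ≥0∞) : EReal) - (maxFn (fun y => w y * F y) x : EReal) := by
    rw [commutator, hmax, maximal_eq_maxFn, EReal.coe_ennreal_mul, EReal.coe_ennreal_ofReal,
      max_eq_left (hb₀ x)]
  have hle : maxFn (fun y => w y * F y) x ≤ w x * maxFn F x + L * fracMax (β / n) F x :=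
    maxFn_mul_le hF ENNReal.coe_ne_top ENNReal.ofReal_ne_top fun γ y hy =>
      ofReal_le_ofReal_add_mul_vol_rpow hβ hb hy
  have hge : w x * maxFn F x ≤ maxFn (fun y => w y * F y) x + L * fracMax (β / n) F x :=
    mul_maxFn_le hF ENNReal.coe_ne_top ENNReal.ofReal_ne_top fun γ y hy =>
      ofReal_le_ofReal_add_mul_vol_rpow hβ hb (mem_pBall_comm.1 hy)
  have hfin : w x * maxFn F x ≠ ∞ :=
    ENNReal.mul_ne_top ENNReal.ofReal_ne_top (maximal_eq_maxFn f ▸ hM)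
  rw [hcomm]
  exact abs_coe_sub_coe_le hfin (ne_top_of_le_ne_top (by finiteness) hle) hge hle

lemma ae_abs_commutator_le [NeZero n] {β : ℝ} (hβ : 0 ≤ β) {b f : Space p n → ℝ} {L : ℝ≥0}
    (hb₀ : ∀ x, 0 ≤ b x) (hb : ∀ x y, |b x - b y| ≤ L * ‖x - y‖ ^ β) {r q : Space p n → ℝ}
    (hrq : IsAdmissiblePair β r q) (hf : MemVarLp r fun x => (f x : EReal)) :
    ∀ᵐ x ∂haar p n, (commutator b f x).abs ≤ L * fracMax (β / n) (fun y => ‖f y‖ₑ) x := by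
  have hfm : AEMeasurable f (haar p n) := hf.aemeasurable_of_coe
  have hfin : luxemburgNorm (haar p n) r (fun y => ‖f y‖ₑ) ≠ ∞ :=
    luxNorm_coe r f ▸ hf.luxNorm_ne_top fun x => (hrq.left.isExponent.one_lt x).le
  have hM := hrq.left.ae_fracMax_lt_top hrq.left le_rfl (fun x => (sub_zero _).symm) hfm.enorm hfin
  have hMβ := hrq.left.ae_fracMax_lt_top hrq.right (by positivity) hrq.eq hfm.enorm hfin
  have hmk : (fun y => ‖f y‖ₑ) =ᵐ[haar p n] fun y => ‖hfm.mk f y‖ₑ :=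
    hfm.ae_eq_mk.mono fun y hy => by simp only [← hy]
  rw [fracMax_congr_ae hmk] at hM hMβ ⊢
  rw [fracMax_zero, ← maximal_eq_maxFn] at hM
  filter_upwards [commutator_congr_ae (Filter.EventuallyEq.refl _ b) hfm.ae_eq_mk, hM, hMβ]
    with x hx hMx hMβx
  rw [hx]
  exact abs_commutator_le hβ hb₀ hb hfm.measurable_mk hMx.ne hMβx.ne

theorem commutatorBounded_of_memLip [NeZero n] {β : ℝ} (hβ : 0 < β) {b b' : Space p n → ℝ}
    (hbb' : b' =ᵐ[haar p n] b) (hb' : MemLip β b') (hb₀ : ∀ x, 0 ≤ b' x) {r q : Space p n → ℝ}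
    (hrq : IsAdmissiblePair β r q) : CommutatorBounded b r q := by
  obtain ⟨L, hL, hLip⟩ := hb'.exists_abs_sub_le hβ.ne'
  obtain ⟨C, hC⟩ := exists_luxemburgNorm_fracMax_le hrq.left hrq.right (α := β / n)
    (by positivity) hrq.eq
  refine ⟨L * C, fun f hf => ?_⟩
  have hpt : ∀ᵐ x ∂haar p n,
      (commutator b f x).abs ≤ L * fracMax (β / n) (fun y => ‖f y‖ₑ) x := by
    filter_upwards [commutator_congr_ae hbb' (Filter.EventuallyEq.refl _ f),
      ae_abs_commutator_le hβ.le hb₀ hLip hrq hf] with x hx hle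
    rwa [← hx]
  have hnorm : luxNorm q (commutator b f) ≤ (L * C : ℝ≥0) * luxNorm r fun x => (f x : EReal) := by
    rw [luxNorm_coe, ENNReal.coe_mul, mul_assoc]
    calc luxNorm q (commutator b f)
        ≤ luxemburgNorm (haar p n) q (fun x => L * fracMax (β / n) (fun y => ‖f y‖ₑ) x) :=
          luxemburgNorm_mono (fun x => (one_pos.trans (hrq.right.isExponent.one_lt x)).le) hpt
      _ ≤ L * luxemburgNorm (haar p n) q (fracMax (β / n) fun y => ‖f y‖ₑ) :=
          luxemburgNorm_const_mul_le _ hL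
      _ ≤ L * (C * luxemburgNorm (haar p n) r fun y => ‖f y‖ₑ) := by
          gcongr
          exact hC _ hf.aemeasurable_of_coe.enorm
  have hfin : luxNorm r (fun x => (f x : EReal)) ≠ ∞ :=
    hf.luxNorm_ne_top fun x => (hrq.left.isExponent.one_lt x).le
  exact ⟨memVarLp_of_luxNorm_ne_top (aemeasurable_commutator (hb'.1.aemeasurable.congr hbb') f)
    (ne_top_of_le_ne_top (by finiteness) hnorm), hnorm⟩

/-! ### The oscillation and the commutator on characteristic functions of balls -/

lemma avg_indicator_pBall_le (F : Space p n → ℝ≥0∞) {γ δ : ℤ} (h : γ ≤ δ) {x y : Space p n}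
    (hy : y ∈ pBall γ x) : avg ((pBall γ x).indicator F) δ y ≤ avg F γ y := by
  calc avg ((pBall γ x).indicator F) δ y
      ≤ (vol p n δ)⁻¹ * ∫⁻ z, (pBall γ x).indicator F z ∂haar p n := avg_le_vol_inv_mul _ δ y
    _ = (vol p n δ)⁻¹ * ∫⁻ z in pBall γ y, F z ∂haar p n := by
        rw [lintegral_indicator (measurableSet_pBall γ x), pBall_eq_of_mem hy]
    _ ≤ (vol p n γ)⁻¹ * ∫⁻ z in pBall γ y, F z ∂haar p n := by
        gcongr
        exact vol_mono p n h
    _ = avg F γ y := (avg_eq F γ y).symm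

lemma maxFn_indicator_pBall (F : Space p n → ℝ≥0∞) {γ : ℤ} {x y : Space p n}
    (hy : y ∈ pBall γ x) :
    maxFn ((pBall γ x).indicator F) y = ⨆ (δ : ℤ) (_ : pBall δ y ⊆ pBall γ x), avg F δ y := by
  refine (iSup_le fun δ => ?_).antisymm (iSup₂_le fun δ hδ => ?_)
  · have hle : ∀ δ', pBall δ' y ⊆ pBall γ x →
        avg F δ' y ≤ ⨆ (δ : ℤ) (_ : pBall δ y ⊆ pBall γ x), avg F δ y :=
      le_iSup₂ (f := fun δ (_ : pBall δ y ⊆ pBall γ x) => avg F δ y)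
    rcases le_total δ γ with h | h
    · rw [avg_indicator (fun z hz => pBall_subset_of_mem h hz), Set.indicator_of_mem hy]
      exact hle δ (pBall_subset_of_mem h hy)
    · exact (avg_indicator_pBall_le F h hy).trans (hle γ (pBall_subset_of_mem le_rfl hy))
  · have havg : avg F δ y = avg ((pBall γ x).indicator F) δ y :=
      avg_congr_on (.of_forall fun z hz => (Set.indicator_of_mem (hδ hz) F).symm)
    exact havg.trans_le (avg_le_maxFn _ δ y)

lemma maximal_indicator (b : Space p n → ℝ) {γ : ℤ} {x y : Space p n} (hy : y ∈ pBall γ x) :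
    maximal ((pBall γ x).indicator b) y = maximalIn (pBall γ x) b y := by
  simp only [maximal_eq_maxFn, enorm_indicator_eq_indicator_enorm, maxFn_indicator_pBall _ hy,
    maximalIn, avgAbs_eq_avg]

lemma maximal_indicator_one {γ : ℤ} {x y : Space p n} (hy : y ∈ pBall γ x) :
    maximal ((pBall γ x).indicator 1) y = 1 := by
  rw [maximal_indicator _ hy, maximalIn]
  simp only [avgAbs_eq_avg, Pi.one_apply, enorm_one, avg_const]
  exact biSup_const ⟨γ, pBall_subset_of_mem le_rfl hy⟩

lemma commutator_indicator_one (b : Space p n → ℝ) {γ : ℤ} {x y : Space p n}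
    (hy : y ∈ pBall γ x) :
    commutator b ((pBall γ x).indicator 1) y = b y - maximalIn (pBall γ x) b y := by
  have hb : (fun z => b z * (pBall γ x).indicator 1 z) = (pBall γ x).indicator b := by
    ext z
    by_cases hz : z ∈ pBall γ x <;> simp [hz]
  rw [commutator, maximal_indicator_one hy, hb, maximal_indicator b hy, EReal.coe_ennreal_one,
    mul_one]

/-- The function `|b - M_B b| χ_B` for the ball `B = B_γ(x)`. -/
def ballDefect (b : Space p n → ℝ) (γ : ℤ) (x : Space p n) : Space p n → ℝ≥0∞ :=
  (pBall γ x).indicator fun y => ((b y : EReal) - (maximalIn (pBall γ x) b y : EReal)).abs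

lemma ballDefect_eq_indicator_commutator (b : Space p n → ℝ) (γ : ℤ) (x : Space p n) :
    ballDefect b γ x =
      (pBall γ x).indicator fun y => (commutator b ((pBall γ x).indicator 1) y).abs :=
  Set.indicator_congr fun y hy => by rw [commutator_indicator_one b hy]

lemma aemeasurable_ballDefect {b : Space p n → ℝ} (hb : AEMeasurable b (haar p n)) (γ : ℤ)
    (x : Space p n) : AEMeasurable (ballDefect b γ x) (haar p n) := by
  rw [ballDefect_eq_indicator_commutator]
  exact (measurable_ereal_abs.comp_aemeasurable (aemeasurable_commutator hb _)).indicator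
    (measurableSet_pBall γ x)

lemma luxNorm_indicator (q : Space p n → ℝ) (E : Set (Space p n)) (f : Space p n → EReal) :
    luxNorm q (E.indicator f) = luxemburgNorm (haar p n) q (E.indicator fun y => (f y).abs) := by
  rw [luxNorm_eq_luxemburgNorm]
  congr 1
  exact (Set.indicator_comp_of_zero (f := f) EReal.abs_zero).symm

lemma luxNorm_indicator_one (q : Space p n → ℝ) (E : Set (Space p n)) :
    luxNorm q (E.indicator fun _ => (1 : EReal)) = luxemburgNorm (haar p n) q (E.indicator 1) := by
  have habs : (1 : EReal).abs = 1 := by rw [← EReal.coe_one, ← enorm_eq_abs_coe, enorm_one]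
  rw [luxNorm_indicator, habs]
  rfl

lemma luxemburgNorm_indicator_pBall_ne_zero {q : Space p n → ℝ} (hq : ∀ x, 1 ≤ q x) (γ : ℤ)
    (x : Space p n) : luxemburgNorm (haar p n) q ((pBall γ x).indicator 1) ≠ 0 :=
  luxemburgNorm_indicator_ne_zero hq (measurableSet_pBall γ x)
    (haar_pBall γ x ▸ vol_ne_zero p n γ)

lemma luxemburgNorm_indicator_pBall_ne_top {q : Space p n → ℝ} (hq : ∀ x, 1 ≤ q x) (γ : ℤ)
    (x : Space p n) : luxemburgNorm (haar p n) q ((pBall γ x).indicator 1) ≠ ∞ :=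
  luxemburgNorm_indicator_ne_top hq (measurableSet_pBall γ x)
    (haar_pBall γ x ▸ vol_ne_top p n γ)

lemma luxemburgNorm_indicator_pBall_le {r q : Space p n → ℝ} (hr : ∀ x, 1 ≤ r x)
    (hq : ∀ x, 1 ≤ q x) {α : ℝ} (hα : 0 ≤ α) (h : ∀ x, 1 / q x = 1 / r x - α) (γ : ℤ)
    (x : Space p n) : luxemburgNorm (haar p n) r ((pBall γ x).indicator 1) ≤
      2 * vol p n γ ^ α * luxemburgNorm (haar p n) q ((pBall γ x).indicator 1) := by
  have hvol := haar_pBall γ x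
  rw [← hvol]
  exact luxemburgNorm_indicator_le hα hr hq h (measurableSet_pBall γ x)
    (hvol ▸ vol_ne_zero p n γ) (hvol ▸ vol_ne_top p n γ)

lemma oscillation_le_iff {β : ℝ} {b q : Space p n → ℝ} (hq : ∀ x, 1 ≤ q x) {K : ℝ≥0∞} :
    oscillation β b q ≤ K ↔ ∀ (γ : ℤ) (x : Space p n),
      luxemburgNorm (haar p n) q (ballDefect b γ x) ≤
        K * vol p n γ ^ (β / n) * luxemburgNorm (haar p n) q ((pBall γ x).indicator 1) := by
  refine iSup₂_le_iff.trans (forall₂_congr fun γ x => ?_)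
  rw [luxNorm_indicator, luxNorm_indicator_one, haar_pBall, one_div, mul_comm, ← div_eq_mul_inv,
    ENNReal.div_le_iff (vol_rpow_ne_zero p n γ _) (vol_rpow_ne_top p n γ _),
    ENNReal.div_le_iff (luxemburgNorm_indicator_pBall_ne_zero hq γ x)
      (luxemburgNorm_indicator_pBall_ne_top hq γ x)]
  rfl

lemma luxNorm_coe_indicator_one (r : Space p n → ℝ) (E : Set (Space p n)) :
    luxNorm r (fun y => ((E.indicator (1 : Space p n → ℝ) y : ℝ) : EReal)) =
      luxemburgNorm (haar p n) r (E.indicator 1) := by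
  simp only [luxNorm_coe, enorm_indicator_eq_indicator_enorm, Pi.one_apply, enorm_one]
  rfl

lemma memVarLp_indicator_one {r : Space p n → ℝ} (hr : ∀ x, 1 ≤ r x) (γ : ℤ) (x : Space p n) :
    MemVarLp r fun y => (((pBall γ x).indicator (1 : Space p n → ℝ) y : ℝ) : EReal) := by
  refine memVarLp_of_luxNorm_ne_top
    (measurable_one.indicator (measurableSet_pBall γ x)).coe_real_ereal.aemeasurable ?_
  rw [luxNorm_coe_indicator_one]
  exact luxemburgNorm_indicator_pBall_ne_top hr γ x

lemma luxemburgNorm_ballDefect_le {b q : Space p n → ℝ} (hq : ∀ x, 0 ≤ q x) (γ : ℤ)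
    (x : Space p n) : luxemburgNorm (haar p n) q (ballDefect b γ x) ≤
      luxNorm q (commutator b ((pBall γ x).indicator 1)) := by
  rw [ballDefect_eq_indicator_commutator]
  exact luxemburgNorm_mono hq (.of_forall fun y => Set.indicator_le_self _ _ y)

theorem oscillation_lt_top {β : ℝ} (hβ : 0 ≤ β) {b r q : Space p n → ℝ}
    (hrq : IsAdmissiblePair β r q) (hb : CommutatorBounded b r q) : oscillation β b q < ∞ := by
  obtain ⟨C, hC⟩ := hb
  have hr : ∀ x, 1 ≤ r x := fun x => (hrq.left.isExponent.one_lt x).le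
  have hq : ∀ x, 1 ≤ q x := fun x => (hrq.right.isExponent.one_lt x).le
  refine ((oscillation_le_iff hq (K := C * 2)).2 fun γ x => ?_).trans_lt (by finiteness)
  calc luxemburgNorm (haar p n) q (ballDefect b γ x)
      ≤ luxNorm q (commutator b ((pBall γ x).indicator 1)) :=
        luxemburgNorm_ballDefect_le (fun y => zero_le_one.trans (hq y)) γ x
    _ ≤ C * luxNorm r fun y => (((pBall γ x).indicator (1 : Space p n → ℝ) y : ℝ) : EReal) :=
        (hC _ (memVarLp_indicator_one hr γ x)).2
    _ = C * luxemburgNorm (haar p n) r ((pBall γ x).indicator 1) := by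
        rw [luxNorm_coe_indicator_one]
    _ ≤ C * (2 * vol p n γ ^ (β / n) *
          luxemburgNorm (haar p n) q ((pBall γ x).indicator 1)) := by
        gcongr
        exact luxemburgNorm_indicator_pBall_le hr hq (by positivity) hrq.eq γ x
    _ = C * 2 * vol p n γ ^ (β / n) * luxemburgNorm (haar p n) q ((pBall γ x).indicator 1) := by
        ring

/-! ### From bounded oscillation to mean oscillation -/

lemma IsLogHolder.exists_avg_mul_luxemburgNorm_indicator_le [NeZero n] {q : Space p n → ℝ}
    (hq : IsLogHolder q) :
    ∃ C : ℝ≥0, ∀ G : Space p n → ℝ≥0∞, AEMeasurable G (haar p n) → ∀ (γ : ℤ) (x : Space p n),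
      avg G γ x * luxemburgNorm (haar p n) q ((pBall γ x).indicator 1) ≤
        C * luxemburgNorm (haar p n) q G := by
  obtain ⟨C, hC⟩ := exists_luxemburgNorm_fracMax_le hq hq le_rfl fun x => (sub_zero _).symm
  have hq₀ : ∀ x, 0 ≤ q x := fun x => (one_pos.trans (hq.isExponent.one_lt x)).le
  refine ⟨C, fun G hG γ x => ENNReal.mul_le_of_forall_lt fun c hc d hd => ?_⟩
  lift c to ℝ≥0 using (hc.trans_le le_top).ne
  rcases eq_zero_or_pos c with rfl | hc₀
  · simp
  calc c * d ≤ c * luxemburgNorm (haar p n) q ((pBall γ x).indicator 1) := by gcongr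
    _ ≤ luxemburgNorm (haar p n) q fun y => c * (pBall γ x).indicator 1 y :=
        mul_luxemburgNorm_le _ hc₀
    _ ≤ luxemburgNorm (haar p n) q (fracMax 0 G) := by
        refine luxemburgNorm_mono hq₀ (.of_forall fun y => ?_)
        by_cases hy : y ∈ pBall γ x
        · rw [Set.indicator_of_mem hy, Pi.one_apply, mul_one, fracMax_zero]
          exact (hc.le.trans_eq (avg_eq_of_mem G hy).symm).trans (avg_le_maxFn G γ y)
        · simp [hy]
    _ ≤ C * luxemburgNorm (haar p n) q G := hC G hG

lemma exists_avg_ballDefect_le [NeZero n] {β : ℝ} {b q : Space p n → ℝ} (hq : IsLogHolder q)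
    (hb : AEMeasurable b (haar p n)) (hosc : oscillation β b q < ∞) :
    ∃ K : ℝ≥0, ∀ (γ : ℤ) (x : Space p n),
      avg (ballDefect b γ x) γ x ≤ K * vol p n γ ^ (β / n) := by
  have hq₁ : ∀ x, 1 ≤ q x := fun x => (hq.isExponent.one_lt x).le
  obtain ⟨C, hC⟩ := hq.exists_avg_mul_luxemburgNorm_indicator_le
  refine ⟨C * (oscillation β b q).toNNReal, fun γ x => ?_⟩
  rw [ENNReal.coe_mul, ENNReal.coe_toNNReal hosc.ne]
  rw [← ENNReal.mul_le_mul_iff_left (luxemburgNorm_indicator_pBall_ne_zero hq₁ γ x)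
    (luxemburgNorm_indicator_pBall_ne_top hq₁ γ x)]
  calc avg (ballDefect b γ x) γ x * luxemburgNorm (haar p n) q ((pBall γ x).indicator 1)
      ≤ C * luxemburgNorm (haar p n) q (ballDefect b γ x) :=
        hC _ (aemeasurable_ballDefect hb γ x) γ x
    _ ≤ C * (oscillation β b q * vol p n γ ^ (β / n) *
          luxemburgNorm (haar p n) q ((pBall γ x).indicator 1)) := by
        gcongr
        exact (oscillation_le_iff hq₁).1 le_rfl γ x
    _ = C * oscillation β b q * vol p n γ ^ (β / n) *
          luxemburgNorm (haar p n) q ((pBall γ x).indicator 1) := by ring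

section ProbabilityMean

variable {Ω : Type*} [MeasurableSpace Ω] {μ : Measure Ω} {f : Ω → ℝ}

lemma integral_max_zero_le_of_lintegral_le (hf : Integrable f μ) {κ : ℝ} (hκ : 0 ≤ κ)
    (h : ∫⁻ y, ENNReal.ofReal (f y) ∂μ ≤ ENNReal.ofReal κ) : ∫ y, max (f y) 0 ∂μ ≤ κ := by
  rw [integral_eq_lintegral_of_nonneg_ae (.of_forall fun y => le_max_right (f y) 0)
    hf.pos_part.aestronglyMeasurable]
  refine ENNReal.toReal_le_of_le_ofReal hκ (le_of_eq_of_le (lintegral_congr fun y => ?_) h)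
  rw [ENNReal.ofReal_max, ENNReal.ofReal_zero, max_eq_left zero_le]

variable [IsProbabilityMeasure μ]

lemma sub_integral_le_integral_max (hf : Integrable f μ) (a : ℝ) :
    a - ∫ y, f y ∂μ ≤ ∫ y, max (a - f y) 0 ∂μ := by
  have hsub : Integrable (fun y => a - f y) μ := (integrable_const a).sub hf
  calc a - ∫ y, f y ∂μ = ∫ y, (a - f y) ∂μ := by
        rw [integral_sub (integrable_const a) hf, integral_const, probReal_univ, one_smul]
    _ ≤ ∫ y, max (a - f y) 0 ∂μ := integral_mono hsub hsub.pos_part fun y => le_max_left _ _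

lemma integral_abs_sub_integral_le (hf : Integrable f μ) {a : ℝ} (ha : ∫ y, f y ∂μ ≤ a) :
    ∫ y, |f y - ∫ z, f z ∂μ| ∂μ ≤ 2 * ∫ y, max (a - f y) 0 ∂μ := by
  have hsub : ∀ c : ℝ, Integrable (fun y => c - f y) μ := fun c => (integrable_const c).sub hf
  set m := ∫ z, f z ∂μ with hm
  have habs : ∀ y, |f y - m| = 2 * max (m - f y) 0 - (m - f y) := by
    intro y
    rcases le_total (f y) m with hy | hy
    · rw [abs_of_nonpos (by linarith), max_eq_left (by linarith)]; ring
    · rw [abs_of_nonneg (by linarith), max_eq_right (by linarith)]; ring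
  have hcenter : ∫ y, (m - f y) ∂μ = 0 := by
    rw [integral_sub (integrable_const m) hf, integral_const, probReal_univ, one_smul, hm,
      sub_self]
  calc ∫ y, |f y - m| ∂μ = 2 * ∫ y, max (m - f y) 0 ∂μ := by
        simp only [habs]
        rw [integral_sub ((hsub m).pos_part.const_mul 2) (hsub m), integral_const_mul, hcenter,
          sub_zero]
    _ ≤ 2 * ∫ y, max (a - f y) 0 ∂μ := by
        refine mul_le_mul_of_nonneg_left ?_ zero_le_two
        exact integral_mono (hsub m).pos_part (hsub a).pos_part fun y =>
          max_le_max_right 0 (sub_le_sub_right ha (f y))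

end ProbabilityMean

lemma ofReal_sub_le_abs_sub {a u : ℝ} {m : ℝ≥0∞} (h : ENNReal.ofReal u ≤ m) :
    ENNReal.ofReal (u - a) ≤ ((a : EReal) - (m : EReal)).abs := by
  rcases eq_or_ne m ∞ with rfl | hm
  · simp
  lift m to ℝ≥0 using hm
  change ENNReal.ofReal (u - a) ≤ ENNReal.ofReal |a - m|
  have hum : u ≤ m := Real.toNNReal_le_iff_le_coe.1 (ENNReal.coe_le_coe.1 h)
  rw [abs_sub_comm]
  exact ENNReal.ofReal_le_ofReal ((sub_le_sub_right hum a).trans (le_abs_self _))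

/-- The mean of a real function over a ball, the counterpart of `avg`. -/
def mean (f : Space p n → ℝ) (γ : ℤ) (x : Space p n) : ℝ := ∫ y, f y ∂ballMeasure γ x

lemma integrable_ballMeasure {f : Space p n → ℝ} (hf : LocallyIntegrable f (haar p n)) (γ : ℤ)
    (x : Space p n) : Integrable f (ballMeasure γ x) := by
  rw [ballMeasure_eq]
  exact (hf.integrableOn_isCompact (isCompact_closedBall x _)).smul_measure
    (ENNReal.inv_ne_top.2 (vol_ne_zero p n γ))

lemma mean_eq_of_mem (f : Space p n → ℝ) {γ : ℤ} {x y : Space p n} (h : y ∈ pBall γ x) :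
    mean f γ y = mean f γ x := by
  rw [mean, mean, ballMeasure_eq_of_mem h]

lemma measurable_mean (b : Space p n → ℝ) (γ : ℤ) : Measurable (mean b γ) :=
  measurable_of_const_on_pBall γ fun _ _ h => mean_eq_of_mem b h

lemma ofReal_mean_abs {b : Space p n → ℝ} (hb : LocallyIntegrable b (haar p n)) (γ : ℤ)
    (x : Space p n) : ENNReal.ofReal (mean (fun y => |b y|) γ x) = avgAbs b γ x := by
  rw [avgAbs_eq_avg, avg, ← ofReal_integral_norm_eq_lintegral_enorm (integrable_ballMeasure hb γ x)]
  rfl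

lemma ofReal_mean_abs_sub_le_ballDefect {b : Space p n → ℝ}
    (hb : LocallyIntegrable b (haar p n)) {γ : ℤ} {x y : Space p n} (hy : y ∈ pBall γ x) :
    ENNReal.ofReal (mean (fun z => |b z|) γ x - b y) ≤ ballDefect b γ x y := by
  rw [ballDefect, Set.indicator_of_mem hy]
  refine ofReal_sub_le_abs_sub ?_
  rw [← mean_eq_of_mem _ hy, ofReal_mean_abs hb]
  exact le_iSup₂ (f := fun δ (_ : pBall δ y ⊆ pBall γ x) => avgAbs b δ y) γ
    (pBall_subset_of_mem le_rfl hy)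

lemma exists_mean_abs_sub_le [NeZero n] {β : ℝ} {b q : Space p n → ℝ} (hq : IsLogHolder q)
    (hb : LocallyIntegrable b (haar p n)) (hosc : oscillation β b q < ∞) :
    ∃ K : ℝ, ∀ (γ : ℤ) (x : Space p n),
      mean (fun y => |b y|) γ x - mean b γ x ≤ K * ((p : ℝ) ^ γ) ^ β ∧
        mean (fun y => |b y - mean b γ x|) γ x ≤ 2 * K * ((p : ℝ) ^ γ) ^ β := by
  obtain ⟨K, hK⟩ := exists_avg_ballDefect_le hq hb.aestronglyMeasurable.aemeasurable hosc
  refine ⟨K, fun γ x => ?_⟩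
  have hbi := integrable_ballMeasure hb γ x
  set a := mean (fun y => |b y|) γ x
  have hexcess : ∫⁻ y, ENNReal.ofReal (a - b y) ∂ballMeasure γ x ≤
      ENNReal.ofReal (K * ((p : ℝ) ^ γ) ^ β) := by
    rw [ENNReal.ofReal_mul K.coe_nonneg, ofReal_radius_rpow (n := n), ENNReal.ofReal_coe_nnreal]
    exact (avg_mono_on (.of_forall fun y => ofReal_mean_abs_sub_le_ballDefect hb)).trans (hK γ x)
  have hpos : ∫ y, max (a - b y) 0 ∂ballMeasure γ x ≤ K * ((p : ℝ) ^ γ) ^ β :=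
    integral_max_zero_le_of_lintegral_le ((integrable_const a).sub hbi) (by positivity) hexcess
  have hmean : mean b γ x ≤ a := integral_mono hbi hbi.abs fun y => le_abs_self (b y)
  rw [mul_assoc]
  exact ⟨(sub_integral_le_integral_max hbi a).trans hpos,
    (integral_abs_sub_integral_le hbi hmean).trans (by gcongr)⟩

/-! ### From mean oscillation to Lipschitz continuity -/

section Campanato

open Filter Topology

lemma tendsto_zpow_atBot_nhdsGT_zero {s : ℝ} (hs : 1 < s) :
    Tendsto (fun γ : ℤ => s ^ γ) atBot (𝓝[>] 0) := by
  refine tendsto_nhdsWithin_iff.2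
    ⟨?_, .of_forall fun γ => Set.mem_Ioi.2 (zpow_pos (one_pos.trans hs) γ)⟩
  simpa only [Function.comp_def, id_eq, Real.rpow_intCast] using
    (tendsto_rpow_atBot_of_base_gt_one s hs).comp (tendsto_intCast_atBot_iff.2 tendsto_id)

lemma tendsto_const_mul_radius_rpow {β : ℝ} (hβ : 0 < β) (K : ℝ) :
    Tendsto (fun γ : ℤ => K * ((p : ℝ) ^ γ) ^ β) atBot (𝓝 0) := by
  have hradius := (tendsto_zpow_atBot_nhdsGT_zero (one_lt_prime_real p)).mono_right
    nhdsWithin_le_nhds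
  simpa only [Real.zero_rpow hβ.ne', mul_zero] using
    (hradius.rpow_const (.inr hβ.le)).const_mul K

lemma exists_tendsto_atBot_of_dist_le {X : Type*} [PseudoMetricSpace X] [CompleteSpace X]
    {m : ℤ → X} {s C : ℝ} (hs : 1 < s) (h : ∀ γ, dist (m γ) (m (γ - 1)) ≤ C * s ^ γ) :
    ∃ l, Tendsto m atBot (𝓝 l) ∧ ∀ γ, dist (m γ) l ≤ C * s ^ γ / (1 - s⁻¹) := by
  have hs₁ : s⁻¹ < 1 := inv_lt_one_of_one_lt₀ hs
  have hgeom : ∀ (γ : ℤ) (k : ℕ),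
      dist (m (γ - k)) (m (γ - (k + 1 : ℕ))) ≤ C * s ^ γ * s⁻¹ ^ k := by
    intro γ k
    have hstep := h (γ - k)
    rwa [sub_sub, ← Nat.cast_add_one, zpow_sub₀ (one_pos.trans hs).ne', zpow_natCast,
      div_eq_mul_inv, ← inv_pow, ← mul_assoc] at hstep
  obtain ⟨l, hl⟩ := cauchySeq_tendsto_of_complete (cauchySeq_of_le_geometric _ _ hs₁ (hgeom 0))
  have hm : Tendsto m atBot (𝓝 l) := by
    rw [← tendsto_comp_neg_atTop_iff, ← Nat.map_cast_int_atTop, tendsto_map'_iff]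
    simpa only [zero_sub, Function.comp_def] using hl
  refine ⟨l, hm, fun γ => ?_⟩
  have hshift : Tendsto (fun k : ℕ => γ - (k : ℤ)) atTop atBot :=
    tendsto_atBot_add_const_left _ γ (tendsto_neg_atBot_iff.2 tendsto_natCast_atTop_atTop)
  simpa using dist_le_of_le_geometric_of_tendsto₀ _ _ hs₁ (hgeom γ) (hm.comp hshift)

lemma ballMeasure_sub_one_le (γ : ℤ) (x : Space p n) :
    ballMeasure (γ - 1) x ≤ (p : ℝ≥0∞) ^ n • ballMeasure γ x := by
  have hp : (p : ℝ≥0∞) ^ n ≠ 0 := pow_ne_zero n (prime_ne_zero p)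
  have hvol : (vol p n (γ - 1))⁻¹ = (p : ℝ≥0∞) ^ n * (vol p n γ)⁻¹ := by
    rw [← sub_add_cancel γ 1, vol_add_one, ENNReal.mul_inv (.inl hp) (.inl (by finiteness)),
      ← mul_assoc, ENNReal.mul_inv_cancel hp (by finiteness), one_mul, add_sub_cancel_right]
  rw [ballMeasure_eq, ballMeasure_eq, hvol, ← smul_smul]
  gcongr
  exact pBall_mono (sub_one_lt γ).le x

lemma abs_mean_sub_mean_sub_one_le {b : Space p n → ℝ} (hb : LocallyIntegrable b (haar p n))
    (γ : ℤ) (x : Space p n) :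
    |mean b γ x - mean b (γ - 1) x| ≤ (p : ℝ) ^ n * mean (fun y => |b y - mean b γ x|) γ x := by
  have hsub : ∀ δ, Integrable (fun y => b y - mean b γ x) (ballMeasure δ x) := fun δ =>
    (integrable_ballMeasure hb δ x).sub (integrable_const _)
  calc |mean b γ x - mean b (γ - 1) x|
      = |∫ y, (b y - mean b γ x) ∂ballMeasure (γ - 1) x| := by
        rw [integral_sub (integrable_ballMeasure hb _ x) (integrable_const _), integral_const,
          probReal_univ, one_smul, abs_sub_comm, mean.eq_def b (γ - 1)]
    _ ≤ ∫ y, |b y - mean b γ x| ∂ballMeasure (γ - 1) x := abs_integral_le_integral_abs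
    _ ≤ ∫ y, |b y - mean b γ x| ∂((p : ℝ≥0∞) ^ n • ballMeasure γ x) :=
        integral_mono_measure (ballMeasure_sub_one_le γ x) (.of_forall fun y => abs_nonneg _)
          ((hsub γ).abs.smul_measure (by finiteness))
    _ = (p : ℝ) ^ n * mean (fun y => |b y - mean b γ x|) γ x := by
        rw [integral_smul_measure, ENNReal.toReal_pow, ENNReal.toReal_natCast, smul_eq_mul]
        rfl

lemma exists_tendsto_mean {β : ℝ} (hβ : 0 < β) {b : Space p n → ℝ}
    (hb : LocallyIntegrable b (haar p n)) {K : ℝ}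
    (h : ∀ (γ : ℤ) (x : Space p n),
      mean (fun y => |b y - mean b γ x|) γ x ≤ K * ((p : ℝ) ^ γ) ^ β) :
    ∃ (b' : Space p n → ℝ) (L : ℝ), ∀ x, Tendsto (fun γ => mean b γ x) atBot (𝓝 (b' x)) ∧
      ∀ γ, |mean b γ x - b' x| ≤ L * ((p : ℝ) ^ γ) ^ β := by
  have hpow : ∀ γ : ℤ, ((p : ℝ) ^ γ) ^ β = ((p : ℝ) ^ β) ^ γ := fun γ =>
    (Real.rpow_zpow_comm p.cast_nonneg β γ).symm
  have hstep : ∀ (x : Space p n) (γ : ℤ),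
      dist (mean b γ x) (mean b (γ - 1) x) ≤ (p : ℝ) ^ n * K * ((p : ℝ) ^ β) ^ γ := by
    intro x γ
    refine (abs_mean_sub_mean_sub_one_le hb γ x).trans ?_
    rw [← hpow, mul_assoc]
    gcongr
    exact h γ x
  choose b' hb' hL using fun x =>
    exists_tendsto_atBot_of_dist_le (Real.one_lt_rpow (one_lt_prime_real p) hβ) (hstep x)
  refine ⟨b', (p : ℝ) ^ n * K / (1 - ((p : ℝ) ^ β)⁻¹), fun x => ⟨hb' x, fun γ => ?_⟩⟩
  rw [hpow, div_mul_eq_mul_div]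
  exact hL x γ

lemma abs_sub_le_of_abs_mean_sub_le {β : ℝ} (hβ : 0 ≤ β) {b b' : Space p n → ℝ} {L : ℝ}
    (h : ∀ (γ : ℤ) (x : Space p n), |mean b γ x - b' x| ≤ L * ((p : ℝ) ^ γ) ^ β)
    {x y : Space p n} (hxy : x ≠ y) : |b' x - b' y| ≤ 2 * L * (p : ℝ) ^ β * ‖x - y‖ ^ β := by
  have hL : 0 ≤ L := by simpa using (abs_nonneg _).trans (h 0 0)
  have hp := one_lt_prime_real p
  have hdist : 0 < ‖x - y‖ := norm_pos_iff.2 (sub_ne_zero.2 hxy)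
  obtain ⟨γ, hlo, hhi⟩ := exists_mem_Ioc_zpow hdist hp
  have hmem : x ∈ pBall (γ + 1) y := by rwa [pBall, mem_closedBall, dist_eq_norm]
  have hradius : ((p : ℝ) ^ (γ + 1)) ^ β ≤ (p : ℝ) ^ β * ‖x - y‖ ^ β := by
    rw [← Real.mul_rpow p.cast_nonneg hdist.le, zpow_add_one₀ (one_pos.trans hp).ne', mul_comm]
    gcongr
  calc |b' x - b' y| ≤ |b' x - mean b (γ + 1) x| + |mean b (γ + 1) x - b' y| := abs_sub_le _ _ _
    _ ≤ L * ((p : ℝ) ^ (γ + 1)) ^ β + L * ((p : ℝ) ^ (γ + 1)) ^ β := by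
        refine add_le_add ((abs_sub_comm _ _).trans_le (h _ x)) ?_
        rw [mean_eq_of_mem b hmem]
        exact h _ y
    _ = 2 * L * ((p : ℝ) ^ (γ + 1)) ^ β := by ring
    _ ≤ 2 * L * (p : ℝ) ^ β * ‖x - y‖ ^ β := by
        rw [mul_assoc _ ((p : ℝ) ^ β)]
        gcongr

lemma memLip_of_abs_sub_le {β L : ℝ} {b : Space p n → ℝ} (hb : Measurable b)
    (h : ∀ x y, x ≠ y → |b x - b y| ≤ L * ‖x - y‖ ^ β) : MemLip β b := by
  refine ⟨hb, lt_of_le_of_lt (b := ENNReal.ofReal L) ?_ ENNReal.ofReal_lt_top⟩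
  refine iSup_le fun x => iSup₂_le fun y hxy => ENNReal.ofReal_le_ofReal ?_
  rw [div_le_iff₀ (Real.rpow_pos_of_pos (norm_pos_iff.2 (sub_ne_zero.2 hxy)) β)]
  exact h x y hxy

instance instIsUnifLocDoublingMeasureHaar : IsUnifLocDoublingMeasure (haar p n) := by
  refine ⟨⟨(p : ℝ≥0) ^ n * (p : ℝ≥0) ^ n, ?_⟩⟩
  filter_upwards [self_mem_nhdsWithin] with ε hε x
  obtain ⟨γ, hlo, hhi⟩ := exists_mem_Ico_zpow hε (one_lt_prime_real p)
  have hsub : closedBall x (2 * ε) ⊆ pBall (γ + 1 + 1) x := by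
    refine closedBall_subset_closedBall ?_
    rw [zpow_add_one₀ (one_pos.trans (one_lt_prime_real p)).ne', mul_comm]
    gcongr
    exact_mod_cast (Fact.out : p.Prime).two_le
  calc haar p n (closedBall x (2 * ε)) ≤ haar p n (pBall (γ + 1 + 1) x) := measure_mono hsub
    _ = ((p : ℝ≥0) ^ n * (p : ℝ≥0) ^ n : ℝ≥0) * haar p n (pBall γ x) := by
        rw [haar_pBall, haar_pBall, vol_add_one, vol_add_one, ← mul_assoc]
        push_cast
        rfl
    _ ≤ ((p : ℝ≥0) ^ n * (p : ℝ≥0) ^ n : ℝ≥0) * haar p n (closedBall x ε) := by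
        gcongr
        exact closedBall_subset_closedBall hlo

lemma ae_tendsto_mean {b : Space p n → ℝ} (hb : LocallyIntegrable b (haar p n)) :
    ∀ᵐ x ∂haar p n, Tendsto (fun γ => mean b γ x) atBot (𝓝 (b x)) := by
  filter_upwards [IsUnifLocDoublingMeasure.ae_tendsto_average (haar p n) hb 1] with x hx
  refine (hx (fun _ : ℤ => x) _ (tendsto_zpow_atBot_nhdsGT_zero (one_lt_prime_real p))
    (.of_forall fun γ => ?_)).congr fun γ => ?_
  · rw [one_mul]
    exact mem_pBall_self γ x
  · rw [average, Measure.restrict_apply_univ]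
    rfl

theorem exists_memLip_of_mean_abs_sub_le {β : ℝ} (hβ : 0 < β) {b : Space p n → ℝ}
    (hb : LocallyIntegrable b (haar p n)) {K : ℝ}
    (h : ∀ (γ : ℤ) (x : Space p n),
      mean (fun y => |b y - mean b γ x|) γ x ≤ K * ((p : ℝ) ^ γ) ^ β) :
    ∃ b' : Space p n → ℝ, b' =ᵐ[haar p n] b ∧ MemLip β b' ∧
      ∀ x, Tendsto (fun γ => mean b γ x) atBot (𝓝 (b' x)) := by
  obtain ⟨b', L, hb'⟩ := exists_tendsto_mean hβ hb h
  have hmeas : Measurable b' :=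
    measurable_of_tendsto_metrizable' atBot (measurable_mean b)
      (tendsto_pi_nhds.2 fun x => (hb' x).1)
  refine ⟨b', ?_, memLip_of_abs_sub_le hmeas fun x y hxy =>
    abs_sub_le_of_abs_mean_sub_le hβ.le (fun γ x => (hb' x).2 γ) hxy, fun x => (hb' x).1⟩
  filter_upwards [ae_tendsto_mean hb] with x hx using tendsto_nhds_unique (hb' x).1 hx

lemma ae_nonneg_of_mean_abs_sub_mean_le {β : ℝ} (hβ : 0 < β) {b : Space p n → ℝ}
    (hb : LocallyIntegrable b (haar p n)) {K : ℝ}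
    (h : ∀ (γ : ℤ) (x : Space p n),
      mean (fun y => |b y|) γ x - mean b γ x ≤ K * ((p : ℝ) ^ γ) ^ β) :
    0 ≤ᵐ[haar p n] b := by
  have habs : LocallyIntegrable (fun y => |b y|) (haar p n) := fun x => (hb x).norm
  filter_upwards [ae_tendsto_mean hb, ae_tendsto_mean habs] with x hx hx'
  have hle : |b x| - b x ≤ 0 :=
    le_of_tendsto_of_tendsto' (hx'.sub hx) (tendsto_const_mul_radius_rpow hβ K) fun γ => h γ x
  exact (abs_nonneg (b x)).trans (sub_nonpos.1 hle)

theorem exists_memLip_of_oscillation_lt_top [NeZero n] {β : ℝ} (hβ : 0 < β)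
    {b q : Space p n → ℝ} (hq : IsLogHolder q) (hb : LocallyIntegrable b (haar p n))
    (hosc : oscillation β b q < ∞) :
    ∃ b' : Space p n → ℝ, b' =ᵐ[haar p n] b ∧ MemLip β b' ∧ ∀ x, 0 ≤ b' x := by
  obtain ⟨K, hK⟩ := exists_mean_abs_sub_le hq hb hosc
  obtain ⟨b', hbb', hb', hlim⟩ :=
    exists_memLip_of_mean_abs_sub_le hβ hb fun γ x => (hK γ x).2
  have hnonneg : 0 ≤ᵐ[haar p n] b :=
    ae_nonneg_of_mean_abs_sub_mean_le hβ hb fun γ x => (hK γ x).1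
  exact ⟨b', hbb', hb', fun x => ge_of_tendsto' (hlim x) fun γ =>
    integral_nonneg_of_ae ((ballMeasure_absolutelyContinuous γ x).ae_le hnonneg)⟩

end Campanato

/-! ### Existence of admissible pairs -/

lemma expInf_const (c : ℝ) {E : Set (Space p n)} (hE : haar p n E ≠ 0) :
    expInf (fun _ => c) E = c :=
  essInf_const _ (by rwa [Ne, Measure.restrict_eq_zero])

lemma expSup_const (c : ℝ) {E : Set (Space p n)} (hE : haar p n E ≠ 0) :
    expSup (fun _ => c) E = c :=
  essSup_const _ (by rwa [Ne, Measure.restrict_eq_zero])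

lemma isLogHolder_const {c : ℝ} (hc : 1 < c) : IsLogHolder (fun _ : Space p n => c) := by
  have huniv : haar p n Set.univ ≠ 0 := NeZero.ne _
  refine ⟨⟨measurable_const, ?_, fun _ => ?_, fun _ => ?_, |c|, fun _ => le_rfl⟩,
    ⟨1, one_pos, fun γ x => ?_⟩, 1, one_pos, fun x y => ?_⟩
  · rwa [expInf_const c huniv]
  · rw [expInf_const c huniv]
  · rw [expSup_const c huniv]
  · have hball : haar p n (pBall γ x) ≠ 0 := haar_pBall γ x ▸ vol_ne_zero p n γ
    rw [expInf_const c hball, expSup_const c hball, sub_self, mul_zero]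
    exact zero_le_one
  · rw [sub_self, abs_zero]
    have hmin : 0 ≤ min ‖x‖ ‖y‖ := le_min (norm_nonneg _) (norm_nonneg _)
    have hp := one_lt_prime_real p
    exact div_nonneg zero_le_one (Real.logb_nonneg hp (by linarith))

lemma exists_isAdmissiblePair {β : ℝ} (hβ₀ : 0 < β) (hβn : β < n) :
    ∃ r q : Space p n → ℝ, IsAdmissiblePair β r q := by
  obtain ⟨c, hc₁, hcβ⟩ := exists_between ((one_lt_div hβ₀).2 hβn)
  have hc₀ : 0 < c := one_pos.trans hc₁
  have hn₀ : (0 : ℝ) < n := hβ₀.trans hβn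
  have hpos : 0 < 1 / c - β / n := by
    rw [sub_pos, ← one_div_div, one_div_lt_one_div (by positivity) hc₀]
    exact hcβ
  have hlt_one : 1 / c - β / n < 1 :=
    (sub_lt_self _ (by positivity)).trans ((div_lt_one hc₀).2 hc₁)
  refine ⟨fun _ => c, fun _ => 1 / (1 / c - β / n), isLogHolder_const hc₁,
    isLogHolder_const ((one_lt_div hpos).2 hlt_one), ?_, fun _ => one_div_one_div _⟩
  rwa [expSup_const c (NeZero.ne _)]

end PadicLip

end

theorem corollary2_general {p : ℕ} [Fact p.Prime] {n : ℕ} {β : ℝ} (hβ₀ : 0 < β) (hβn : β < n)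
    {b : PadicLip.Space p n → ℝ} (hb : LocallyIntegrable b (PadicLip.haar p n)) :
    List.TFAE [
      (∃ b' : PadicLip.Space p n → ℝ,
        b' =ᵐ[PadicLip.haar p n] b ∧ PadicLip.MemLip β b' ∧ (∀ x, 0 ≤ b' x)),
      (∀ r q : PadicLip.Space p n → ℝ, PadicLip.IsAdmissiblePair β r q →
        PadicLip.CommutatorBounded b r q),
      (∃ r q : PadicLip.Space p n → ℝ, PadicLip.IsAdmissiblePair β r q ∧
        PadicLip.CommutatorBounded b r q),
      (∃ r q : PadicLip.Space p n → ℝ, PadicLip.IsAdmissiblePair β r q ∧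
        PadicLip.oscillation β b q < ∞),
      (∀ r q : PadicLip.Space p n → ℝ, PadicLip.IsAdmissiblePair β r q →
        PadicLip.oscillation β b q < ∞)] := by
  have : NeZero n := ⟨by rintro rfl; exact (hβ₀.trans hβn).ne' Nat.cast_zero⟩
  obtain ⟨r₀, q₀, h₀⟩ := PadicLip.exists_isAdmissiblePair (p := p) hβ₀ hβn
  tfae_have 1 → 2 := fun ⟨_, hbb', hb', hnonneg⟩ _ _ hrq =>
    PadicLip.commutatorBounded_of_memLip hβ₀ hbb' hb' hnonneg hrq
  tfae_have 2 → 3 := fun h => ⟨r₀, q₀, h₀, h r₀ q₀ h₀⟩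
  tfae_have 3 → 4 := fun ⟨r, q, hrq, h⟩ => ⟨r, q, hrq, PadicLip.oscillation_lt_top hβ₀.le hrq h⟩
  tfae_have 4 → 1 := fun ⟨_, _, hrq, h⟩ =>
    PadicLip.exists_memLip_of_oscillation_lt_top hβ₀ hrq.right hb h
  tfae_have 2 → 5 := fun h r q hrq => PadicLip.oscillation_lt_top hβ₀.le hrq (h r q hrq)
  tfae_have 5 → 4 := fun h => ⟨r₀, q₀, h₀, h r₀ q₀ h₀⟩
  tfae_finish

theorem corollary2 (p : ℕ) [Fact p.Prime] (n : ℕ) (hn : 1 ≤ n) (β : ℝ) (hβ₀ : 0 < β) (hβ₁ : β < 1)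
    (b : PadicLip.Space p n → ℝ) (hb : LocallyIntegrable b (PadicLip.haar p n)) :
    List.TFAE [
      (∃ b' : PadicLip.Space p n → ℝ,
        b' =ᵐ[PadicLip.haar p n] b ∧ PadicLip.MemLip β b' ∧ (∀ x, 0 ≤ b' x)),
      (∀ r q : PadicLip.Space p n → ℝ, PadicLip.IsAdmissiblePair β r q →
        PadicLip.CommutatorBounded b r q),
      (∃ r q : PadicLip.Space p n → ℝ, PadicLip.IsAdmissiblePair β r q ∧
        PadicLip.CommutatorBounded b r q),
      (∃ r q : PadicLip.Space p n → ℝ, PadicLip.IsAdmissiblePair β r q ∧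
        PadicLip.oscillation β b q < ∞),
      (∀ r q : PadicLip.Space p n → ℝ, PadicLip.IsAdmissiblePair β r q →
        PadicLip.oscillation β b q < ∞)] :=
  corollary2_general hβ₀ (hβ₁.trans_le (by exact_mod_cast hn)) hb
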